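/- Let $\mathcal H,\mathcal G$ be real Hilbert spaces, $M:\mathcal H\to\mathcal G$ a bounded linear operator, $f:\mathcal H\to\mathbb R$ convex and differentiable with $L_f$-Lipschitz gradient, i.e. $f(x)\le f(y)+\langle x-y,\nabla f(y)\rangle+\frac{L_f}{2}\|x-y\|^2$ for all $x,y$ (with $L_f\ge 0$, and $L_f>0$ or $M\ne0$), and let $g:\mathcal H\to(-\infty,+\infty]$ and $h:\mathcal G\to(-\infty,+\infty]$ be proper, lower semicontinuous and convex with $M(\operatorname{dom} g)\cap\operatorname{dom}h\neq\emptyset$. Let $F^\star=\inf_x\{f(x)+g(x)+h(Mx)\}$ and let $\mathcal P^\star$ be the set of minimizers, assumed non-empty. Let $h^*$ be the conjugate of $h$, let $\mathcal L(x,y)=f(x)+g(x)+\langle Mx,y\rangle-h^*(y)$ be the Lagrangian and let $\mathcal D^\star$ be the set of maximizers of $y\mapsto\inf_x\mathcal L(x,y)$. Let $S$ be a bounded self-adjoint operator on $\mathcal G$ with $\langle y,Sy\rangle\ge\sigma\|y\|^2$ for some $\sigma>0$ and all $y$; put $\|y\|_S=\sqrt{\langle y,Sy\rangle}$, $\|y\|_{S^{-1}}=\sqrt{\langle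 y,S^{-1}y\rangle}$ and $\|M\|_{S^{-1}}=\sup_{x\ne0}\|Mx\|_{S^{-1}}/\|x\|$. Fix $\dot y\in\mathcal G$ and, for $\beta>0$, let $y^*_\beta(u;\dot y)=\operatorname{argmax}_{y}\{\langle u,y\rangle-h^*(y)-\frac\beta2\|y-\dot y\|_S^2\}$. Given $\tau_0=1$, $\beta_0>0$ and $\bar x^0,\tilde x^0\in\mathcal H$, let the algorithm generate, for $k=0,1,\dots$: $\hat x^k=(1-\tau_k)\bar x^k+\tau_k\tilde x^k$; $\beta_{k+1}=\beta_k/(1+\tau_k)$ and $B_{k+1}=L_f+\|M\|_{S^{-1}}^2/\beta_{k+1}$; $v^k=M^*y^*_{\beta_{k+1}}(M\hat x^k;\dot y)$; $\tilde x^{k+1}=\operatorname{prox}_{\frac1{\tau_kB_{k+1}}g}\big(\tilde x^k-\frac1{\tau_kB_{k+1}}(\nabla f(\hat x^k)+v^k)\big)$; $\bar x^{k+1}=\hat x^k+\tau_k(\tilde x^{k+1}-\tilde x^k)$; and $\tau_{k+1}$ the unique positive root of $\frac{B_{k+1}-L_f}{B_{k+1}}\tau^3+\tau^2+\tau_k^2\tau-\tau_k^2=0$.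 In particular $\beta_1=\beta_0/2$. For a convex set $C$, let $\operatorname{ri}C$ be the set of $x\in C$ such that the cone generated by $C-x$ equals the linear span of $C-x$. (i) Suppose that $h=\iota_{\{c\}}$ for some $c\in\mathcal G$ and that $\operatorname{ri}(\operatorname{dom}g)\cap\{x: Mx=c\}\ne\emptyset$. Write $F=f+g$. Let $(x^\star,y^\star)\in\mathcal P^\star\times\mathcal D^\star$ and suppose that either the subspace $M(\operatorname{span}(\operatorname{dom}g-\operatorname{dom}g))$ is closed in $\mathcal G$ (which is automatic in finite dimension) or $(x^\star,y^\star)$ is a saddle point of $\mathcal L$. Then for all $k\in\mathbb N$: $$F(\bar x^{k+1})-F(x^\star)\ge-\|y^\star\|_S\,\|M\bar x^{k+1}-c\|_{S^{-1}},$$ $$F(\bar x^{k+1})-F(x^\star)\le\frac1{k+1}\Big(\frac{L_f}2+\frac{\|M\|_{S^{-1}}^2}{2\beta_1}\Big)\|\tilde x^0-x^\star\|^2+\|y^\star\|_S\,\|M\bar x^{k+1}-c\|_{S^{-1}}+\frac{\beta_0}{2(k+1)}\|y^\star-\dot y\|_S^2,$$ $$\|M\bar x^{k+1}-c\|_{S^{-1}}\le\frac{\beta_0}{k+1}\bigg[\|y^\star-\dot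 y\|_S+\bigg(\|y^\star-\dot y\|_S^2+\frac2{\beta_0}\Big(\frac{L_f}2+\frac{\|M\|_{S^{-1}}^2}{2\beta_1}\Big)\|\tilde x^0-x^\star\|^2\bigg)^{1/2}\bigg].$$ (ii) Suppose that $h$ is $D_{\mathcal Y}$-Lipschitz continuous with respect to the norm dual to $\|\cdot\|_S$, i.e. $|h(u)-h(v)|\le D_{\mathcal Y}\|u-v\|_{S^{-1}}$ for all $u,v$. Write $F(x)=f(x)+g(x)+h(Mx)$. Then for all $x^\star\in\mathcal P^\star$ and all $k\in\mathbb N$: $$F(\bar x^{k+1})-F^\star\le\frac1{k+1}\Big(\frac{L_f}2+\frac{\|M\|_{S^{-1}}^2}{2\beta_1}\Big)\|\tilde x^0-x^\star\|^2+\frac{\beta_0}{k+1}\big[D_{\mathcal Y}^2+\|\dot y\|_S^2\big].$$ -/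

import Mathlib

open scoped Gradient InnerProductSpace

noncomputable section

namespace SmoothASGARD

variable {H G : Type*}
  [NormedAddCommGroup H] [InnerProductSpace ℝ H] [CompleteSpace H]
  [NormedAddCommGroup G] [InnerProductSpace ℝ G] [CompleteSpace G]

/-- `φ` is a proper, lower semicontinuous, convex function with values in `(-∞, +∞]`
(convexity is convexity of the epigraph). -/
structure IsProperLscConvex {E : Type*} [NormedAddCommGroup E] [InnerProductSpace ℝ E]
    (φ : E → EReal) : Prop where
  ne_bot : ∀ x, φ x ≠ ⊥
  exists_lt_top : ∃ x, φ x < ⊤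
  lsc : LowerSemicontinuous φ
  convex : Convex ℝ {p : E × ℝ | φ p.1 ≤ (p.2 : EReal)}

/-- The effective domain of an extended-real-valued function. -/
def dom {E : Type*} (φ : E → EReal) : Set E := {x | φ x < ⊤}

/-- The real function `f` is convex and differentiable, and its gradient is `L`-Lipschitz, expressed
by the quadratic upper bound. -/
structure IsConvexWithLipschitzGradient (f : H → ℝ) (L : ℝ) : Prop where
  convex : ConvexOn ℝ Set.univ f
  differentiable : Differentiable ℝ f
  le_quadratic : ∀ x y, f x ≤ f y + ⟪x - y, ∇ f y⟫_ℝ + L / 2 * ‖x - y‖ ^ 2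

/-- `S` is a (bounded, self-adjoint) positive definite operator: `⟪y, S y⟫ ≥ σ ‖y‖ ^ 2` for some
`σ > 0`. -/
structure IsPositiveDefinite (S : G →L[ℝ] G) : Prop where
  selfAdjoint : IsSelfAdjoint S
  coercive : ∃ σ : ℝ, 0 < σ ∧ ∀ y, σ * ‖y‖ ^ 2 ≤ ⟪y, S y⟫_ℝ

/-- The norm `‖y‖_S = √⟪y, S y⟫`. The norm `‖·‖_{S⁻¹}` is `normOp S.inverse`. -/
def normOp (S : G →L[ℝ] G) (y : G) : ℝ := √⟪y, S y⟫_ℝ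

/-- A positive definite operator is invertible, so that `S.inverse` is its inverse. -/
theorem IsPositiveDefinite.isInvertible {S : G →L[ℝ] G} (hS : IsPositiveDefinite S) :
    S.IsInvertible := by
  obtain ⟨σ, hσ, h⟩ := hS.coercive
  have hc : IsCoercive ((innerSL ℝ).comp S : G →L[ℝ] G →L[ℝ] ℝ) := by
    refine ⟨σ, hσ, fun u => ?_⟩
    have := h u
    simp only [ContinuousLinearMap.comp_apply, innerSL_apply_apply]
    rw [real_inner_comm]
    nlinarith [this]
  refine ⟨hc.continuousLinearEquivOfBilin, ?_⟩
  ext v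
  refine ext_inner_right ℝ fun w => ?_
  simp [hc.continuousLinearEquivOfBilin_apply]

/-- The operator norm `‖M‖_{S⁻¹} = sup_{x ≠ 0} ‖M x‖_{S⁻¹} / ‖x‖`. -/
def opNormInv (S : G →L[ℝ] G) (M : H →L[ℝ] G) : ℝ :=
  ⨆ x : {x : H // x ≠ 0}, normOp S.inverse (M x) / ‖(x : H)‖

/-- The Fenchel-Moreau conjugate `h*(y) = sup_u (⟪u, y⟫ - h u)`. -/
def conj (h : G → EReal) (y : G) : EReal := ⨆ u : G, ((⟪u, y⟫_ℝ : ℝ) : EReal) - h u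

/-- The function `ȳ ↦ ⟪y, ȳ⟫ - h*(ȳ) - (β / 2) ‖ȳ - ẏ‖_S ^ 2`, whose supremum is the `β`-smooth
approximation of `h` at `y`. -/
def smoothObjective (h : G → EReal) (S : G →L[ℝ] G) (ydot : G) (β : ℝ) (y ybar : G) : EReal :=
  ((⟪y, ybar⟫_ℝ : ℝ) : EReal) - conj h ybar - ((β / 2 * normOp S (ybar - ydot) ^ 2 : ℝ) : EReal)

/-- `p = y*_β(y; ẏ)`, the maximizer in the definition of the `β`-smooth approximation of `h`. -/
def IsSmoothArgmax (h : G → EReal) (S : G →L[ℝ] G) (ydot : G) (β : ℝ) (y p : G) : Prop :=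
  ∀ ybar, smoothObjective h S ydot β y ybar ≤ smoothObjective h S ydot β y p

/-- `p = prox_{γ g}(x)`, the minimizer of `z ↦ γ g z + ‖z - x‖ ^ 2 / 2`. -/
def IsProx (γ : ℝ) (g : H → EReal) (x p : H) : Prop :=
  ∀ z, (γ : EReal) * g p + ((1 / 2 * ‖p - x‖ ^ 2 : ℝ) : EReal) ≤
    (γ : EReal) * g z + ((1 / 2 * ‖z - x‖ ^ 2 : ℝ) : EReal)

/-- The sequences `τ, β, B` (`B` is used from index `1` on), `xhat`, `xbar`, `xtil`, `ystar` are
generated by the linearized ASGARD algorithm with initial parameter `β₀`; the starting points are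
`xbar 0` and `xtil 0`. -/
structure IsLinearizedASGARD (f : H → ℝ) (g : H → EReal) (h : G → EReal) (M : H →L[ℝ] G)
    (S : G →L[ℝ] G) (ydot : G) (L β₀ : ℝ) (τ β B : ℕ → ℝ) (xhat xbar xtil : ℕ → H)
    (ystar : ℕ → G) : Prop where
  tau_zero : τ 0 = 1
  beta_zero : β 0 = β₀
  xhat_eq : ∀ k, xhat k = (1 - τ k) • xbar k + τ k • xtil k
  beta_succ : ∀ k, β (k + 1) = β k / (1 + τ k)
  B_succ : ∀ k, B (k + 1) = L + opNormInv S M ^ 2 / β (k + 1)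
  ystar_argmax : ∀ k, IsSmoothArgmax h S ydot (β (k + 1)) (M (xhat k)) (ystar k)
  xtil_succ : ∀ k, IsProx (1 / (τ k * B (k + 1))) g
    (xtil k - (1 / (τ k * B (k + 1))) • (∇ f (xhat k) + M.adjoint (ystar k))) (xtil (k + 1))
  xbar_succ : ∀ k, xbar (k + 1) = xhat k + τ k • (xtil (k + 1) - xtil k)
  tau_succ_pos : ∀ k, 0 < τ (k + 1)
  tau_succ : ∀ k, (B (k + 1) - L) / B (k + 1) * τ (k + 1) ^ 3 + τ (k + 1) ^ 2
    + τ k ^ 2 * τ (k + 1) - τ k ^ 2 = 0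

/-- The primal objective `f + g + h ∘ M`. -/
def primalObj (f : H → ℝ) (g : H → EReal) (h : G → EReal) (M : H →L[ℝ] G) (x : H) : EReal :=
  (f x : EReal) + g x + h (M x)

/-- The set of primal solutions. -/
def primalSolutions (f : H → ℝ) (g : H → EReal) (h : G → EReal) (M : H →L[ℝ] G) : Set H :=
  {x | ∀ z, primalObj f g h M x ≤ primalObj f g h M z}

/-- The Lagrangian `(x, y) ↦ f x + g x + ⟪M x, y⟫ - h*(y)`. -/
def lagrangian (f : H → ℝ) (g : H → EReal) (h : G → EReal) (M : H →L[ℝ] G) (x : H) (y : G) :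
    EReal :=
  (f x : EReal) + g x + ((⟪M x, y⟫_ℝ : ℝ) : EReal) - conj h y

/-- The dual objective. -/
def dualObj (f : H → ℝ) (g : H → EReal) (h : G → EReal) (M : H →L[ℝ] G) (y : G) : EReal :=
  ⨅ x : H, lagrangian f g h M x y

/-- The set of dual solutions. -/
def dualSolutions (f : H → ℝ) (g : H → EReal) (h : G → EReal) (M : H →L[ℝ] G) : Set G :=
  {y | ∀ z, dualObj f g h M z ≤ dualObj f g h M y}

/-- `(x, y)` is a saddle point of the Lagrangian. -/
def IsSaddlePoint (f : H → ℝ) (g : H → EReal) (h : G → EReal) (M : H →L[ℝ] G) (x : H) (y : G) :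
    Prop :=
  ∀ (x' : H) (y' : G), lagrangian f g h M x y' ≤ lagrangian f g h M x y ∧
    lagrangian f g h M x y ≤ lagrangian f g h M x' y

open Classical in
/-- The indicator function of the set `{c}`: zero at `c` and `+∞` elsewhere. -/
def indicatorPoint (c : G) (y : G) : EReal := if y = c then 0 else ⊤

/-- The relative interior of a convex set `C`: the points `x` of `C` such that the cone generated
by `C - x` is the linear span of `C - x`. It contains Mathlib's `intrinsicInterior`, and coincides
with it in finite dimension. -/
def relInterior (C : Set H) : Set H :=
  {x | x ∈ C ∧ ∀ v ∈ vectorSpan ℝ C, ∃ t : ℝ, 0 < t ∧ ∃ z ∈ C, v = t • (z - x)}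

end SmoothASGARD

end

/-! Both rates come from one estimate, `smoothed_gap_le`: for every `y` in `dom (conj h)`, the
quantity `F(x̄) + ⟪M x̄, y⟫ - h*(y) - β/2 ‖y - ẏ‖_S²` with `F = f + g` exceeds the optimal value by
at most `‖x̃⁰ - x⋆‖²` times `(B₁/2)/(k+1)`. Keeping `y` free replaces the smoothed version of `h` by
a family of real inequalities.

The estimate is a telescoped accelerated proximal-gradient argument. In `accelerated_step`,
quadratic growth at the proximal point and at the smooth maximizer pays for the descent errors of
`f` and of the smoothed coupling term; `B = L + ‖M‖²/β` is exactly the curvature required. The cubic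
for `τ` says `τ_{k+1}² B_{k+2} = (1 - τ_{k+1}) τ_k² B_{k+1}`, so the distance terms telescope. From
`τ_k ≥ 1/(k+1)`, both `τ_k² B_{k+1}` and `β_{k+1}` are `O(1/k)`.

For an equality constraint, a dual solution is a Lagrange multiplier
(`le_lagrangian_of_mem_dualSolutions`), which bounds the objective gap from below. Taking `y = y⋆`
bounds it from above, and maximizing over `y` gives a quadratic inequality for the residual. For
Lipschitz `h`, `y` is a subgradient of `h` at `M x̄`; it lies in a ball of radius `|D|`.

Multipliers and subgradients both come from `exists_lagrange_multiplier`: Baire's theorem gives the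
epigraph of the value function an interior point, and Hahn-Banach then separates. -/

noncomputable section

namespace SmoothASGARD

/-! ### The dual norms induced by `S` and its inverse. -/

section Operators

variable {H G : Type*}
  [NormedAddCommGroup H] [InnerProductSpace ℝ H]
  [NormedAddCommGroup G] [InnerProductSpace ℝ G]
  {S : G →L[ℝ] G}

theorem normOp_nonneg (S : G →L[ℝ] G) (y : G) : 0 ≤ normOp S y := Real.sqrt_nonneg _

theorem norm_add_smul_sq (a d : H) (t : ℝ) :
    ‖a + t • d‖ ^ 2 = (1 - t) * ‖a‖ ^ 2 + t * ‖a + d‖ ^ 2 - t * (1 - t) * ‖d‖ ^ 2 := by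
  simp only [← real_inner_self_eq_norm_sq, inner_add_left, inner_add_right, inner_smul_left,
    inner_smul_right, conj_trivial, real_inner_comm a d]
  ring

theorem normOp_inverse_le (S : G →L[ℝ] G) (M : H →L[ℝ] G) (x : H) :
    normOp S.inverse (M x) ≤ opNormInv S M * ‖x‖ := by
  rcases eq_or_ne x 0 with rfl | hx
  · simp [normOp]
  -- Boundedness matters: a real supremum of an unbounded family would be the default value 0.
  have hb : BddAbove (Set.range fun x : {x : H // x ≠ 0} =>
      normOp S.inverse (M x) / ‖(x : H)‖) := by
    refine ⟨√(‖S.inverse‖ * ‖M‖ ^ 2), ?_⟩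
    rintro _ ⟨⟨z, hz⟩, rfl⟩
    have hz' : 0 < ‖z‖ := norm_pos_iff.2 hz
    rw [div_le_iff₀ hz']
    refine Real.sqrt_le_iff.2 ⟨by positivity, ?_⟩
    rw [mul_pow, Real.sq_sqrt (by positivity)]
    calc ⟪M z, S.inverse (M z)⟫_ℝ ≤ ‖M z‖ * ‖S.inverse (M z)‖ := real_inner_le_norm _ _
      _ ≤ ‖M z‖ * (‖S.inverse‖ * ‖M z‖) := by gcongr; exact S.inverse.le_opNorm _
      _ = ‖S.inverse‖ * ‖M z‖ ^ 2 := by ring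
      _ ≤ ‖S.inverse‖ * (‖M‖ * ‖z‖) ^ 2 := by gcongr; exact M.le_opNorm _
      _ = _ := by ring
  have h := le_ciSup hb ⟨x, hx⟩
  rwa [div_le_iff₀ (norm_pos_iff.2 hx)] at h

variable [CompleteSpace G]

theorem IsPositiveDefinite.apply_inverse (hS : IsPositiveDefinite S) (y : G) :
    S (S.inverse y) = y := hS.isInvertible.self_apply_inverse y

theorem IsPositiveDefinite.inverse_apply (hS : IsPositiveDefinite S) (y : G) :
    S.inverse (S y) = y := hS.isInvertible.inverse_apply_self y

theorem IsPositiveDefinite.inner_comm (hS : IsPositiveDefinite S) (x y : G) :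
    ⟪x, S y⟫_ℝ = ⟪y, S x⟫_ℝ := by
  rw [← ContinuousLinearMap.adjoint_inner_left,
    ContinuousLinearMap.isSelfAdjoint_iff'.1 hS.selfAdjoint, real_inner_comm]

theorem IsPositiveDefinite.inner_nonneg (hS : IsPositiveDefinite S) (y : G) :
    0 ≤ ⟪y, S y⟫_ℝ := by
  obtain ⟨σ, hσ, h⟩ := hS.coercive
  exact le_trans (by positivity) (h y)

theorem IsPositiveDefinite.inner_inverse_nonneg (hS : IsPositiveDefinite S) (y : G) :
    0 ≤ ⟪y, S.inverse y⟫_ℝ := by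
  have := hS.inner_nonneg (S.inverse y)
  rwa [hS.apply_inverse, real_inner_comm] at this

theorem IsPositiveDefinite.normOp_sq (hS : IsPositiveDefinite S) (y : G) :
    normOp S y ^ 2 = ⟪y, S y⟫_ℝ := Real.sq_sqrt (hS.inner_nonneg y)

theorem IsPositiveDefinite.normOp_inverse_sq (hS : IsPositiveDefinite S) (y : G) :
    normOp S.inverse y ^ 2 = ⟪y, S.inverse y⟫_ℝ := Real.sq_sqrt (hS.inner_inverse_nonneg y)

/-- The quadratic form of a linear combination of `S⁻¹ w` and `z`. -/
theorem IsPositiveDefinite.quadratic_nonneg (hS : IsPositiveDefinite S) (w z : G) (t : ℝ) :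
    0 ≤ normOp S z ^ 2 * (t * t) + (-2 * ⟪w, z⟫_ℝ) * t + normOp S.inverse w ^ 2 := by
  have h := hS.inner_nonneg (S.inverse w - t • z)
  rw [hS.normOp_sq, hS.normOp_inverse_sq]
  simp only [map_sub, map_smul, inner_sub_left, inner_sub_right, inner_smul_left,
    inner_smul_right, hS.apply_inverse] at h
  have h1 : ⟪S.inverse w, S z⟫_ℝ = ⟪w, z⟫_ℝ := by
    rw [hS.inner_comm, hS.apply_inverse, real_inner_comm]
  rw [h1, real_inner_comm w z, real_inner_comm w (S.inverse w)] at h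
  simp only [conj_trivial] at h
  linarith

/-- Cauchy-Schwarz, from the discriminant of the nonnegative quadratic `t ↦ ‖S⁻¹ w - t z‖_S²`. -/
theorem IsPositiveDefinite.inner_le (hS : IsPositiveDefinite S) (w z : G) :
    ⟪w, z⟫_ℝ ≤ normOp S z * normOp S.inverse w := by
  have h := discrim_le_zero (hS.quadratic_nonneg w z)
  have hn : 0 ≤ normOp S z * normOp S.inverse w :=
    mul_nonneg (normOp_nonneg _ _) (normOp_nonneg _ _)
  refine le_of_sq_le_sq ?_ hn
  unfold discrim at h
  nlinarith

theorem IsPositiveDefinite.neg_le_inner (hS : IsPositiveDefinite S) (w z : G) :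
    -(normOp S z * normOp S.inverse w) ≤ ⟪w, z⟫_ℝ := by
  have h := hS.inner_le (-w) z
  have hn : normOp S.inverse (-w) = normOp S.inverse w := by simp [normOp]
  rw [hn, inner_neg_left] at h
  linarith

/-- Young's inequality: the same quadratic evaluated at `t = b` and divided by `2 b`. -/
theorem IsPositiveDefinite.inner_le_add (hS : IsPositiveDefinite S) (w z : G) {b : ℝ}
    (hb : 0 < b) :
    ⟪w, z⟫_ℝ ≤ b / 2 * normOp S z ^ 2 + 1 / (2 * b) * normOp S.inverse w ^ 2 := by
  have h := mul_nonneg (by positivity : 0 ≤ 1 / (2 * b)) (hS.quadratic_nonneg w z b)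
  have e : 1 / (2 * b) * (normOp S z ^ 2 * (b * b) + (-2 * ⟪w, z⟫_ℝ) * b +
      normOp S.inverse w ^ 2) = b / 2 * normOp S z ^ 2 - ⟪w, z⟫_ℝ
        + 1 / (2 * b) * normOp S.inverse w ^ 2 := by
    field_simp
    ring
  linarith

theorem IsPositiveDefinite.normOp_inverse_apply (hS : IsPositiveDefinite S) (y : G) :
    normOp S.inverse (S y) = normOp S y := by
  rw [normOp, hS.inverse_apply, real_inner_comm, normOp]

theorem IsPositiveDefinite.normOp_apply_inverse (hS : IsPositiveDefinite S) (y : G) :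
    normOp S (S.inverse y) = normOp S.inverse y := by
  rw [normOp, hS.apply_inverse, real_inner_comm, normOp]

theorem IsPositiveDefinite.normOp_sub_sq_le (hS : IsPositiveDefinite S) (y z : G) :
    normOp S (y - z) ^ 2 ≤ 2 * (normOp S y ^ 2 + normOp S z ^ 2) := by
  have h := hS.inner_nonneg (y + z)
  simp only [hS.normOp_sq, map_sub, map_add, inner_sub_left, inner_sub_right, inner_add_left,
    inner_add_right] at h ⊢
  linarith

theorem IsPositiveDefinite.normOp_add_smul_sq (hS : IsPositiveDefinite S) (a d : G) (t : ℝ) :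
    normOp S (a + t • d) ^ 2 =
      (1 - t) * normOp S a ^ 2 + t * normOp S (a + d) ^ 2 - t * (1 - t) * normOp S d ^ 2 := by
  simp only [hS.normOp_sq, map_add, map_smul, inner_add_left, inner_add_right, inner_smul_left,
    inner_smul_right, conj_trivial]
  rw [hS.inner_comm a d]
  ring

theorem IsPositiveDefinite.normOp_inverse_pos (hS : IsPositiveDefinite S) {y : G} (hy : y ≠ 0) :
    0 < normOp S.inverse y := by
  obtain ⟨σ, hσ, h⟩ := hS.coercive
  rw [← hS.normOp_apply_inverse]
  have hne : S.inverse y ≠ 0 := fun h0 => hy (by rw [← hS.apply_inverse y, h0, map_zero])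
  have := norm_pos_iff.2 hne
  exact Real.sqrt_pos.2 (lt_of_lt_of_le (by positivity) (h (S.inverse y)))

theorem IsPositiveDefinite.opNormInv_sq_pos (hS : IsPositiveDefinite S) {M : H →L[ℝ] G}
    (hM : M ≠ 0) : 0 < opNormInv S M ^ 2 := by
  refine lt_of_le_of_ne (sq_nonneg _) fun h0 => hM ?_
  have h0' : opNormInv S M = 0 := pow_eq_zero_iff two_ne_zero |>.1 h0.symm
  ext x
  by_contra hx
  have h := normOp_inverse_le S M x
  rw [h0', zero_mul] at h
  exact absurd (hS.normOp_inverse_pos hx) (not_lt.2 h)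

end Operators

/-! ### Growth at minimizers and the gradient inequality. -/

section Convexity

variable {E : Type*} [NormedAddCommGroup E] [InnerProductSpace ℝ E]

/-- Quadratic growth at the minimizer of the sum of a convex function and a quadratic form. -/
theorem add_quadratic_le_of_isMinOn {C : Set E} {φ Q : E → ℝ} (hφ : ConvexOn ℝ C φ)
    (hQ : ∀ a d t, Q (a + t • d) = (1 - t) * Q a + t * Q (a + d) - t * (1 - t) * Q d)
    {a p : E} (hp : p ∈ C) (hmin : ∀ z ∈ C, φ p + Q (p - a) ≤ φ z + Q (z - a))
    {z : E} (hz : z ∈ C) : φ p + Q (p - a) + Q (z - p) ≤ φ z + Q (z - a) := by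
  -- Minimality is tested at `p + t (z - p)`; dividing by `t` leaves the factor `1 - t` on the
  -- growth term, removed by letting `t → 0`.
  have key : ∀ t ∈ Set.Ioo (0 : ℝ) 1,
      φ p + Q (p - a) + (1 - t) * Q (z - p) ≤ φ z + Q (z - a) := by
    rintro t ⟨ht0, ht1⟩
    have hc := hφ.2 hp hz (by linarith : 0 ≤ 1 - t) ht0.le (by ring)
    have hm := hmin _ (hφ.1 hp hz (by linarith : 0 ≤ 1 - t) ht0.le (by ring))
    have e : (1 - t) • p + t • z - a = (p - a) + t • (z - p) := by module
    rw [e, hQ, show p - a + (z - p) = z - a by abel] at hm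
    simp only [smul_eq_mul] at hc
    have : t * (φ p + Q (p - a) + (1 - t) * Q (z - p)) ≤ t * (φ z + Q (z - a)) := by
      linarith
    exact le_of_mul_le_mul_left this ht0
  have hlim : Filter.Tendsto (fun t : ℝ => φ p + Q (p - a) + (1 - t) * Q (z - p))
      (nhdsWithin 0 (Set.Ioi 0)) (nhds (φ p + Q (p - a) + (1 - 0) * Q (z - p))) := by
    refine Filter.Tendsto.mono_left (Continuous.tendsto ?_ 0) nhdsWithin_le_nhds
    fun_prop
  have := le_of_tendsto hlim (Filter.mem_of_superset (Ioo_mem_nhdsGT one_pos) key)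
  simpa using this

theorem IsConvexWithLipschitzGradient.add_inner_le [CompleteSpace E] {f : E → ℝ} {L : ℝ}
    (hf : IsConvexWithLipschitzGradient f L) (x y : E) :
    f x + ⟪y - x, ∇ f x⟫_ℝ ≤ f y := by
  have hc : ConvexOn ℝ Set.univ (f ∘ AffineMap.lineMap (k := ℝ) x y) := by
    simpa using hf.convex.comp_affineMap (AffineMap.lineMap (k := ℝ) x y)
  have hd : HasDerivAt (f ∘ AffineMap.lineMap (k := ℝ) x y) (fderiv ℝ f x (y - x)) 0 := by
    have h1 : HasFDerivAt f (fderiv ℝ f x) (AffineMap.lineMap x y (0 : ℝ)) := by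
      simpa using (hf.differentiable x).hasFDerivAt
    exact h1.comp_hasDerivAt (0 : ℝ) AffineMap.hasDerivAt_lineMap
  have h := hc.le_slope_of_hasDerivAt (Set.mem_univ 0) (Set.mem_univ 1) one_pos hd
  have e : ⟪y - x, ∇ f x⟫_ℝ = fderiv ℝ f x (y - x) := by simp [inner_gradient_right]
  rw [e]
  simp only [slope, sub_zero, inv_one, one_smul, vsub_eq_sub, Function.comp_apply,
    AffineMap.lineMap_apply_zero, AffineMap.lineMap_apply_one] at h
  linarith

end Convexity

/-! ### Roots of the cubic defining the step sizes. -/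

section StepSizes

/-- Since `c ≤ 1`, the cubic gives `s² (1 - t) ≤ t² (1 + t)`. If `t (k + 2) < 1`, then `t (k + 1) <
1 - t`, and multiplying by `(k + 1)²` yields `1 - t < (1 - t)² (1 + t)`, impossible for `0 < t < 1`.
-/
theorem one_div_le_of_cubic_root {c s t : ℝ} {k : ℕ} (hc1 : c ≤ 1) (ht : 0 < t)
    (hs : 1 / ((k : ℝ) + 1) ≤ s)
    (h : c * t ^ 3 + t ^ 2 + s ^ 2 * t - s ^ 2 = 0) : 1 / ((k : ℝ) + 2) ≤ t := by
  by_contra hlt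
  push Not at hlt
  have hk : (0 : ℝ) ≤ k := k.cast_nonneg
  rw [lt_div_iff₀ (by positivity)] at hlt
  rw [div_le_iff₀ (by positivity)] at hs
  have hs0 : 0 < s := by
    by_contra hs0
    push Not at hs0
    nlinarith
  have h1t : t < 1 := by nlinarith
  have h2 : t ^ 2 * ((k : ℝ) + 1) ^ 2 * (1 + t) ≥ (1 - t) := by
    have : s ^ 2 * (1 - t) ≤ t ^ 2 * (1 + t) := by nlinarith [pow_pos ht 3]
    have h3 : 1 ≤ s ^ 2 * ((k : ℝ) + 1) ^ 2 := by nlinarith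
    nlinarith [sq_nonneg ((k : ℝ) + 1)]
  have h4 : t * ((k : ℝ) + 1) < 1 - t := by linarith
  have h5 : t ^ 2 * ((k : ℝ) + 1) ^ 2 < (1 - t) ^ 2 := by
    have : 0 ≤ t * ((k : ℝ) + 1) := by positivity
    nlinarith
  nlinarith

theorem cubic_root_lt_one {c s t : ℝ} (hc : 0 ≤ c) (ht : 0 < t)
    (h : c * t ^ 3 + t ^ 2 + s ^ 2 * t - s ^ 2 = 0) : t < 1 := by
  by_contra hlt
  push Not at hlt
  have := mul_nonneg hc (pow_pos ht 3).le
  nlinarith [sq_nonneg s]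

end StepSizes

/-! ### Real inequalities on effective domains. -/

section ExtendedReal

theorem coe_toReal_of_mem_dom {E : Type*} {φ : E → EReal} (hbot : ∀ x, φ x ≠ ⊥) {x : E} (hx : x ∈ dom φ) :
    ((φ x).toReal : EReal) = φ x := EReal.coe_toReal (ne_of_lt hx) (hbot x)

variable {E : Type*} [NormedAddCommGroup E] [InnerProductSpace ℝ E]

theorem convexOn_toReal {φ : E → EReal} (hbot : ∀ x, φ x ≠ ⊥)
    (hconv : Convex ℝ {p : E × ℝ | φ p.1 ≤ (p.2 : EReal)}) :
    ConvexOn ℝ (dom φ) fun x => (φ x).toReal := by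
  have key : ∀ ⦃x⦄, x ∈ dom φ → ∀ ⦃y⦄, y ∈ dom φ → ∀ ⦃a b : ℝ⦄, 0 ≤ a → 0 ≤ b → a + b = 1 →
      φ (a • x + b • y) ≤ ((a * (φ x).toReal + b * (φ y).toReal : ℝ) : EReal) := by
    intro x hx y hy a b ha hb hab
    have h1 : (x, (φ x).toReal) ∈ {p : E × ℝ | φ p.1 ≤ (p.2 : EReal)} :=
      (coe_toReal_of_mem_dom hbot hx).ge
    have h2 : (y, (φ y).toReal) ∈ {p : E × ℝ | φ p.1 ≤ (p.2 : EReal)} :=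
      (coe_toReal_of_mem_dom hbot hy).ge
    exact hconv h1 h2 ha hb hab
  have hdom : Convex ℝ (dom φ) := fun x hx y hy a b ha hb hab =>
    (key hx hy ha hb hab).trans_lt (EReal.coe_lt_top _)
  refine ⟨hdom, fun x hx y hy a b ha hb hab => ?_⟩
  have h := key hx hy ha hb hab
  rw [← coe_toReal_of_mem_dom hbot (hdom hx hy ha hb hab)] at h
  exact EReal.coe_le_coe_iff.1 h

theorem IsProperLscConvex.convexOn_toReal {φ : E → EReal} (hφ : IsProperLscConvex φ) :
    ConvexOn ℝ (dom φ) fun x => (φ x).toReal :=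
  SmoothASGARD.convexOn_toReal hφ.ne_bot hφ.convex

theorem conj_le_coe_iff {h : E → EReal} (hbot : ∀ x, h x ≠ ⊥) {y : E} {r : ℝ} :
    conj h y ≤ (r : EReal) ↔ ∀ u ∈ dom h, ⟪u, y⟫_ℝ - (h u).toReal ≤ r := by
  rw [conj, iSup_le_iff]
  refine forall_congr' fun u => ?_
  by_cases hu : u ∈ dom h
  · rw [← coe_toReal_of_mem_dom hbot hu]
    simp only [hu, forall_const, EReal.toReal_coe]
    exact_mod_cast Iff.rfl
  · have : h u = ⊤ := not_lt_top_iff.1 hu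
    simp [hu, this]

theorem conj_ne_bot {h : E → EReal} (hh : IsProperLscConvex h) (y : E) : conj h y ≠ ⊥ := by
  obtain ⟨u, hu⟩ := hh.exists_lt_top
  intro h0
  have h1 := (conj_le_coe_iff hh.ne_bot (y := y) (r := ⟪u, y⟫_ℝ - (h u).toReal - 1)).1
    (by rw [h0]; exact bot_le) u hu
  linarith

theorem inner_sub_conj_le {h : E → EReal} (hh : IsProperLscConvex h) {u y : E} (hu : u ∈ dom h)
    (hy : y ∈ dom (conj h)) : ⟪u, y⟫_ℝ - (conj h y).toReal ≤ (h u).toReal := by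
  have := (conj_le_coe_iff hh.ne_bot).1 (coe_toReal_of_mem_dom (conj_ne_bot hh) hy).ge u hu
  linarith

theorem convexOn_conj {h : E → EReal} (hh : IsProperLscConvex h) :
    ConvexOn ℝ (dom (conj h)) fun y => (conj h y).toReal := by
  refine SmoothASGARD.convexOn_toReal (conj_ne_bot hh) ?_
  rintro ⟨y, r⟩ hy ⟨z, s⟩ hz a b ha hb hab
  simp only [Set.mem_ofPred_eq, Prod.smul_mk, Prod.mk_add_mk, smul_eq_mul] at hy hz ⊢
  rw [conj_le_coe_iff hh.ne_bot] at hy hz ⊢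
  intro u hu
  rw [inner_add_right, inner_smul_right, inner_smul_right]
  have h1 := mul_le_mul_of_nonneg_left (hy u hu) ha
  have h2 := mul_le_mul_of_nonneg_left (hz u hu) hb
  have h3 : a * (h u).toReal + b * (h u).toReal = (h u).toReal := by rw [← add_mul, hab, one_mul]
  linarith

/-- Nonemptiness of `dom (conj h)` is needed: otherwise the objective is `⊥` everywhere and any
point is a maximizer. -/
theorem IsSmoothArgmax.real {h : E → EReal} (hh : IsProperLscConvex h) {S : E →L[ℝ] E}
    {ydot u p : E} {b : ℝ} (hp : IsSmoothArgmax h S ydot b u p) (hne : (dom (conj h)).Nonempty) :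
    p ∈ dom (conj h) ∧ ∀ y ∈ dom (conj h),
      ⟪u, y⟫_ℝ - (conj h y).toReal - b / 2 * normOp S (y - ydot) ^ 2 ≤
        ⟪u, p⟫_ℝ - (conj h p).toReal - b / 2 * normOp S (p - ydot) ^ 2 := by
  have hval : ∀ y ∈ dom (conj h), smoothObjective h S ydot b u y =
      ((⟪u, y⟫_ℝ - (conj h y).toReal - b / 2 * normOp S (y - ydot) ^ 2 : ℝ) : EReal) := by
    intro y hy
    rw [smoothObjective, ← coe_toReal_of_mem_dom (conj_ne_bot hh) hy]
    simp only [EReal.toReal_coe, EReal.coe_sub]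
  have hpd : p ∈ dom (conj h) := by
    obtain ⟨y, hy⟩ := hne
    by_contra hpn
    have h1 := hp y
    have : conj h p = ⊤ := not_lt_top_iff.1 hpn
    rw [hval y hy, smoothObjective, this] at h1
    rw [show ((⟪u, p⟫_ℝ : ℝ) : EReal) - ⊤ = ⊥ from rfl, EReal.bot_sub, le_bot_iff] at h1
    exact EReal.coe_ne_bot _ h1
  refine ⟨hpd, fun y hy => ?_⟩
  have h1 := hp y
  rw [hval y hy, hval p hpd] at h1
  exact EReal.coe_le_coe_iff.1 h1

theorem IsProx.real {g : E → EReal} (hg : IsProperLscConvex g) {b : ℝ} (hb : 0 < b) {x p : E}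
    (hp : IsProx (1 / b) g x p) :
    p ∈ dom g ∧ ∀ z ∈ dom g,
      (g p).toReal + b / 2 * ‖p - x‖ ^ 2 ≤ (g z).toReal + b / 2 * ‖z - x‖ ^ 2 := by
  have hb' : 0 < 1 / b := by positivity
  have hval : ∀ z ∈ dom g, ((1 / b : ℝ) : EReal) * g z + ((1 / 2 * ‖z - x‖ ^ 2 : ℝ) : EReal) =
      ((1 / b * (g z).toReal + 1 / 2 * ‖z - x‖ ^ 2 : ℝ) : EReal) := by
    intro z hz
    rw [← coe_toReal_of_mem_dom hg.ne_bot hz]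
    simp only [EReal.toReal_coe, EReal.coe_add, EReal.coe_mul]
  have hpd : p ∈ dom g := by
    obtain ⟨z, hz⟩ := hg.exists_lt_top
    by_contra hpn
    have h1 := hp z
    have : g p = ⊤ := not_lt_top_iff.1 hpn
    rw [hval z hz, this, EReal.coe_mul_top_of_pos hb', EReal.top_add_coe, top_le_iff] at h1
    exact EReal.coe_ne_top _ h1
  refine ⟨hpd, fun z hz => ?_⟩
  have h1 := hp z
  rw [hval z hz, hval p hpd, EReal.coe_le_coe_iff] at h1
  have h2 := mul_le_mul_of_nonneg_left h1 hb.le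
  field_simp at h2 ⊢
  linarith

end ExtendedReal

/-! ### Parameter decay, the one-step inequality and its telescoping. -/

section Parameters

variable {H G : Type*}
  [NormedAddCommGroup H] [InnerProductSpace ℝ H] [CompleteSpace H]
  [NormedAddCommGroup G] [InnerProductSpace ℝ G] [CompleteSpace G]
  {f : H → ℝ} {g : H → EReal} {h : G → EReal} {M : H →L[ℝ] G} {L : ℝ}
  {S : G →L[ℝ] G} {ydot : G} {β₀ : ℝ} {τ β B : ℕ → ℝ} {xhat xbar xtil : ℕ → H} {ystar : ℕ → G}

namespace IsLinearizedASGARD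


theorem tau_pos (halg : IsLinearizedASGARD f g h M S ydot L β₀ τ β B xhat xbar xtil ystar)
    (k : ℕ) : 0 < τ k := by
  cases k with
  | zero => simp [halg.tau_zero]
  | succ k => exact halg.tau_succ_pos k

theorem beta_pos (halg : IsLinearizedASGARD f g h M S ydot L β₀ τ β B xhat xbar xtil ystar)
    (hβ₀ : 0 < β₀) (k : ℕ) : 0 < β k := by
  induction k with
  | zero => simpa [halg.beta_zero]
  | succ k ih =>
    rw [halg.beta_succ]
    have := halg.tau_pos k
    positivity

theorem B_pos (halg : IsLinearizedASGARD f g h M S ydot L β₀ τ β B xhat xbar xtil ystar)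
    (hβ₀ : 0 < β₀) (hL : 0 ≤ L) (hLM : 0 < L ∨ M ≠ 0) (hS : IsPositiveDefinite S) (k : ℕ) :
    0 < B (k + 1) := by
  rw [halg.B_succ]
  have hβ := halg.beta_pos hβ₀ (k + 1)
  rcases hLM with h0 | h0
  · positivity
  · have := hS.opNormInv_sq_pos h0
    positivity

theorem ratio_mem_Icc
    (halg : IsLinearizedASGARD f g h M S ydot L β₀ τ β B xhat xbar xtil ystar)
    (hβ₀ : 0 < β₀) (hL : 0 ≤ L) (hLM : 0 < L ∨ M ≠ 0) (hS : IsPositiveDefinite S) (k : ℕ) :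
    (B (k + 1) - L) / B (k + 1) ∈ Set.Icc 0 1 := by
  have hB := halg.B_pos hβ₀ hL hLM hS k
  have hβ := halg.beta_pos hβ₀ (k + 1)
  have h1 : B (k + 1) - L = opNormInv S M ^ 2 / β (k + 1) := by rw [halg.B_succ]; ring
  refine ⟨div_nonneg (h1 ▸ by positivity) hB.le, ?_⟩
  rw [div_le_one hB]
  linarith

theorem one_div_le_tau
    (halg : IsLinearizedASGARD f g h M S ydot L β₀ τ β B xhat xbar xtil ystar)
    (hβ₀ : 0 < β₀) (hL : 0 ≤ L) (hLM : 0 < L ∨ M ≠ 0) (hS : IsPositiveDefinite S) (k : ℕ) :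
    1 / ((k : ℝ) + 1) ≤ τ k := by
  induction k with
  | zero => simp [halg.tau_zero]
  | succ k ih =>
    have := one_div_le_of_cubic_root (halg.ratio_mem_Icc hβ₀ hL hLM hS k).2
      (halg.tau_succ_pos k) ih (halg.tau_succ k)
    push_cast
    rwa [add_assoc, one_add_one_eq_two]

theorem tau_le_one
    (halg : IsLinearizedASGARD f g h M S ydot L β₀ τ β B xhat xbar xtil ystar)
    (hβ₀ : 0 < β₀) (hL : 0 ≤ L) (hLM : 0 < L ∨ M ≠ 0) (hS : IsPositiveDefinite S) (k : ℕ) :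
    τ k ≤ 1 := by
  cases k with
  | zero => simp [halg.tau_zero]
  | succ k =>
    exact (cubic_root_lt_one (halg.ratio_mem_Icc hβ₀ hL hLM hS k).1
      (halg.tau_succ_pos k) (halg.tau_succ k)).le

/-- This is the cubic equation multiplied by `B (k + 1)`, once `B (k + 2)` is written as `B (k + 1)
+ τ (k + 1) * (B (k + 1) - L)`. -/
theorem tau_sq_mul_B
    (halg : IsLinearizedASGARD f g h M S ydot L β₀ τ β B xhat xbar xtil ystar)
    (hβ₀ : 0 < β₀) (hL : 0 ≤ L) (hLM : 0 < L ∨ M ≠ 0) (hS : IsPositiveDefinite S) (k : ℕ) :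
    τ (k + 1) ^ 2 * B (k + 2) = (1 - τ (k + 1)) * (τ k ^ 2 * B (k + 1)) := by
  have hB := halg.B_pos hβ₀ hL hLM hS k
  have hβ := halg.beta_pos hβ₀ (k + 1)
  have hτ := halg.tau_succ_pos k
  have h1 : B (k + 1) - L = opNormInv S M ^ 2 / β (k + 1) := by rw [halg.B_succ]; ring
  have h2 : B (k + 2) = B (k + 1) + τ (k + 1) * (B (k + 1) - L) := by
    rw [h1, halg.B_succ (k + 1), halg.beta_succ (k + 1), halg.B_succ k]
    field_simp
    ring
  have h3 := halg.tau_succ k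
  rw [h2]
  field_simp at h3
  linarith

theorem tau_sq_mul_B_le
    (halg : IsLinearizedASGARD f g h M S ydot L β₀ τ β B xhat xbar xtil ystar)
    (hβ₀ : 0 < β₀) (hL : 0 ≤ L) (hLM : 0 < L ∨ M ≠ 0) (hS : IsPositiveDefinite S) (k : ℕ) :
    τ k ^ 2 * B (k + 1) ≤ 1 / ((k : ℝ) + 1) * B 1 := by
  induction k with
  | zero => simp [halg.tau_zero]
  | succ k ih =>
    rw [halg.tau_sq_mul_B hβ₀ hL hLM hS]
    have h1 := halg.one_div_le_tau hβ₀ hL hLM hS (k + 1)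
    have h2 := halg.tau_le_one hβ₀ hL hLM hS (k + 1)
    have hB := halg.B_pos hβ₀ hL hLM hS 0
    push_cast at h1 ⊢
    calc (1 - τ (k + 1)) * (τ k ^ 2 * B (k + 1))
        ≤ (1 - τ (k + 1)) * (1 / ((k : ℝ) + 1) * B 1) :=
          mul_le_mul_of_nonneg_left ih (by linarith)
      _ ≤ (1 - 1 / ((k : ℝ) + 1 + 1)) * (1 / ((k : ℝ) + 1) * B 1) :=
          mul_le_mul_of_nonneg_right (by linarith) (mul_nonneg (by positivity) hB.le)
      _ = _ := by field_simp; ring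

theorem beta_succ_le
    (halg : IsLinearizedASGARD f g h M S ydot L β₀ τ β B xhat xbar xtil ystar)
    (hβ₀ : 0 < β₀) (hL : 0 ≤ L) (hLM : 0 < L ∨ M ≠ 0) (hS : IsPositiveDefinite S) (k : ℕ) :
    β (k + 1) ≤ β₀ / ((k : ℝ) + 1) := by
  have key : ∀ k : ℕ, β k ≤ β₀ / ((k : ℝ) + 1) := by
    intro k
    induction k with
    | zero => simp [halg.beta_zero]
    | succ k ih =>
      have h1 := halg.one_div_le_tau hβ₀ hL hLM hS k
      rw [halg.beta_succ]
      push_cast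
      calc β k / (1 + τ k) ≤ (β₀ / ((k : ℝ) + 1)) / (1 + 1 / ((k : ℝ) + 1)) := by gcongr
        _ = _ := by field_simp
  -- The induction gives the sharper `β₀ / (k + 2)`, relaxed here.
  refine (key (k + 1)).trans ?_
  push_cast
  gcongr
  linarith

end IsLinearizedASGARD

/-- One iteration of the algorithm, for fixed parameters. -/
theorem accelerated_step (hf : IsConvexWithLipschitzGradient f L)
    (hS : IsPositiveDefinite S) {C : Set H} {γ : H → ℝ} (hγ : ConvexOn ℝ C γ)
    {D : Set G} {q : G → ℝ} (hq : ConvexOn ℝ D q) {b t K : ℝ} (hb : 0 < b) (ht : 0 < t)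
    (ht1 : t ≤ 1) (hK : K = L + opNormInv S M ^ 2 / b) (hK0 : 0 < K)
    {xh x xt xt' x' xs : H} {p y : G}
    (hxh : xh = (1 - t) • x + t • xt) (hx' : x' = xh + t • (xt' - xt)) (hp : p ∈ D)
    (hpmax : ∀ y ∈ D, ⟪M xh, y⟫_ℝ - q y - b / 2 * normOp S (y - ydot) ^ 2 ≤
      ⟪M xh, p⟫_ℝ - q p - b / 2 * normOp S (p - ydot) ^ 2)
    (hxt : xt' ∈ C)
    (hprox : ∀ z ∈ C, γ xt' + (t * K) / 2 *
        ‖xt' - (xt - (1 / (t * K)) • (∇ f xh + M.adjoint p))‖ ^ 2 ≤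
      γ z + (t * K) / 2 * ‖z - (xt - (1 / (t * K)) • (∇ f xh + M.adjoint p))‖ ^ 2)
    (hγx : γ x' ≤ (1 - t) * γ x + t * γ xt') (hxs : xs ∈ C) (hy : y ∈ D) :
    f x' + γ x' + ⟪M x', y⟫_ℝ - q y - b / 2 * normOp S (y - ydot) ^ 2
        + t ^ 2 * K / 2 * ‖xt' - xs‖ ^ 2 ≤
      (1 - t) * (f x + γ x + ⟪M x, p⟫_ℝ - q p - (1 + t) * b / 2 * normOp S (p - ydot) ^ 2)
        + t * (f xs + γ xs + (⟪M xs, p⟫_ℝ - q p)) + t ^ 2 * K / 2 * ‖xt - xs‖ ^ 2 := by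
  have htK : 0 < t * K := mul_pos ht hK0
  -- the proximal step
  have h1 := add_quadratic_le_of_isMinOn hγ (Q := fun v => (t * K) / 2 * ‖v‖ ^ 2)
    (fun a d s => by simp only [norm_add_smul_sq]; ring) hxt hprox hxs
  set w := ∇ f xh + M.adjoint p with hw
  have hexp : ∀ z : H, (t * K) / 2 * ‖z - (xt - (1 / (t * K)) • w)‖ ^ 2 =
      (t * K) / 2 * ‖z - xt‖ ^ 2 + ⟪z - xt, w⟫_ℝ + 1 / (2 * (t * K)) * ‖w‖ ^ 2 := by
    intro z
    rw [show z - (xt - (1 / (t * K)) • w) = (z - xt) + (1 / (t * K)) • w by module,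
      norm_add_sq_real, inner_smul_right, norm_smul, Real.norm_eq_abs, mul_pow, sq_abs]
    field_simp
  simp only [hexp] at h1
  -- the smoothed term
  have h2 := add_quadratic_le_of_isMinOn (φ := fun z => q z - ⟪M xh, z⟫_ℝ) (a := ydot)
    (hq.sub ((innerₛₗ ℝ (M xh)).concaveOn hq.1))
    (Q := fun v => b / 2 * normOp S v ^ 2)
    (fun a d s => by simp only [hS.normOp_add_smul_sq]; ring) hp
    (fun z hz => by have := hpmax z hz; linarith) hy
  have h3 := hS.inner_le_add (M (x' - xh)) (y - p) hb
  have h4 : normOp S.inverse (M (x' - xh)) ^ 2 ≤ opNormInv S M ^ 2 * ‖x' - xh‖ ^ 2 := by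
    rw [← mul_pow]
    exact pow_le_pow_left₀ (normOp_nonneg _ _) (normOp_inverse_le S M _) 2
  have h5 : 1 / (2 * b) * normOp S.inverse (M (x' - xh)) ^ 2 ≤
      1 / (2 * b) * (opNormInv S M ^ 2 * ‖x' - xh‖ ^ 2) :=
    mul_le_mul_of_nonneg_left h4 (by positivity)
  -- The two descent errors add up to `t` times the proximal term in `‖xt' - xt‖²`, so they cancel
  -- in the final sum.
  have h6 : L / 2 * ‖x' - xh‖ ^ 2 + 1 / (2 * b) * (opNormInv S M ^ 2 * ‖x' - xh‖ ^ 2) =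
      t * (t * K / 2 * ‖xt' - xt‖ ^ 2) := by
    have e : x' - xh = t • (xt' - xt) := by rw [hx']; abel
    rw [e, norm_smul, Real.norm_eq_abs, mul_pow, sq_abs, hK]
    field_simp
  -- the smooth term
  have h7 := hf.le_quadratic x' xh
  have h8 := mul_le_mul_of_nonneg_left (hf.add_inner_le xh x) (by linarith : 0 ≤ 1 - t)
  have h9 := mul_le_mul_of_nonneg_left (hf.add_inner_le xh xs) ht.le
  have h10 := mul_le_mul_of_nonneg_left h1 ht.le
  have e0 : x' - xh = (1 - t) • (x - xh) + t • (xs - xh) + t • (xt' - xs) := by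
    rw [hx', hxh]; module
  have e1 : ⟪x' - xh, ∇ f xh⟫_ℝ = (1 - t) * ⟪x - xh, ∇ f xh⟫_ℝ + t * ⟪xs - xh, ∇ f xh⟫_ℝ
      + t * ⟪xt' - xs, ∇ f xh⟫_ℝ := by
    rw [e0, inner_add_left, inner_add_left, real_inner_smul_left, real_inner_smul_left,
      real_inner_smul_left]
  have e2 : ⟪M x', p⟫_ℝ = (1 - t) * ⟪M x, p⟫_ℝ + t * ⟪M xs, p⟫_ℝ
      + t * ⟪xt' - xs, M.adjoint p⟫_ℝ := by
    have : x' = (1 - t) • x + t • xs + t • (xt' - xs) := by rw [hx', hxh]; module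
    rw [ContinuousLinearMap.adjoint_inner_right, this]
    simp only [map_add, map_smul, inner_add_left, real_inner_smul_left]
  have e3 : ⟪xt' - xt, w⟫_ℝ - ⟪xs - xt, w⟫_ℝ =
      ⟪xt' - xs, ∇ f xh⟫_ℝ + ⟪xt' - xs, M.adjoint p⟫_ℝ := by
    rw [← inner_sub_left, sub_sub_sub_cancel_right, hw, inner_add_right]
  have e4 : ⟪M (x' - xh), y - p⟫_ℝ = ⟪M x', y⟫_ℝ - ⟪M xh, y⟫_ℝ - ⟪M x', p⟫_ℝ + ⟪M xh, p⟫_ℝ := by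
    rw [map_sub, inner_sub_left, inner_sub_right, inner_sub_right]; ring
  -- The slack left by `(1 - t) (1 + t) = 1 - t²` in the smoothing terms at `p`.
  have h11 : 0 ≤ t ^ 2 * (b / 2 * normOp S (p - ydot) ^ 2) := by positivity
  rw [norm_sub_rev xs xt', norm_sub_rev xs xt] at h10
  have e5 : t * (⟪xt' - xt, w⟫_ℝ - ⟪xs - xt, w⟫_ℝ) =
    t * (⟪xt' - xs, ∇ f xh⟫_ℝ + ⟪xt' - xs, M.adjoint p⟫_ℝ) := by rw [e3]
  linarith

/-- The estimate on the smoothed gap along the iterations, from which both rates follow. -/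
theorem IsLinearizedASGARD.smoothed_gap_le
    (halg : IsLinearizedASGARD f g h M S ydot L β₀ τ β B xhat xbar xtil ystar)
    (hβ₀ : 0 < β₀) (hL : 0 ≤ L) (hLM : 0 < L ∨ M ≠ 0) (hf : IsConvexWithLipschitzGradient f L)
    (hg : IsProperLscConvex g) (hh : IsProperLscConvex h) (hS : IsPositiveDefinite S)
    (hne : (dom (conj h)).Nonempty) {xs : H} (hxs : xs ∈ dom g) (hMxs : M xs ∈ dom h) (k : ℕ) :
    xbar (k + 1) ∈ dom g ∧ ∀ y ∈ dom (conj h),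
      f (xbar (k + 1)) + (g (xbar (k + 1))).toReal + ⟪M (xbar (k + 1)), y⟫_ℝ
          - (conj h y).toReal - β (k + 1) / 2 * normOp S (y - ydot) ^ 2 ≤
        f xs + (g xs).toReal + (h (M xs)).toReal
          + 1 / ((k : ℝ) + 1) * (L / 2 + opNormInv S M ^ 2 / (2 * β 1)) * ‖xtil 0 - xs‖ ^ 2 := by
  have hcg := hg.convexOn_toReal
  have hτ := fun k => halg.tau_pos k
  have hτ1 := fun k => halg.tau_le_one hβ₀ hL hLM hS k
  have hB := fun k => halg.B_pos hβ₀ hL hLM hS k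
  have hβ := fun k => halg.beta_pos hβ₀ k
  have hmax := fun k => (halg.ystar_argmax k).real hh hne
  have hprox := fun k => (halg.xtil_succ k).real hg (mul_pos (hτ k) (hB k))
  have hcomb : ∀ k, xbar (k + 1) = (1 - τ k) • xbar k + τ k • xtil (k + 1) := fun k => by
    rw [halg.xbar_succ, halg.xhat_eq]; module
  have hone : xbar 1 = xtil 1 := by
    have := hcomb 0
    simpa [halg.tau_zero] using this
  have hdom : ∀ k, xbar (k + 1) ∈ dom g := by
    intro k
    induction k with
    | zero => exact hone ▸ (hprox 0).1
    | succ k ih =>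
      rw [hcomb]
      exact hcg.1 ih (hprox _).1 (by linarith [hτ1 (k + 1)]) (hτ _).le (by ring)
  have hconv : ∀ k, (g (xbar (k + 1))).toReal ≤
      (1 - τ k) * (g (xbar k)).toReal + τ k * (g (xtil (k + 1))).toReal := by
    intro k
    cases k with
    -- As `τ 0 = 1`, the value at `xbar 0` has coefficient 0, so `xbar 0` need not lie in `dom g`.
    | zero => simp [hone, halg.tau_zero]
    | succ k =>
      rw [hcomb (k + 1)]
      exact hcg.2 (hdom k) (hprox _).1 (by linarith [hτ1 (k + 1)]) (hτ _).le (by ring)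
  have hstep := fun k y (hy : y ∈ dom (conj h)) =>
    accelerated_step hf hS hcg (convexOn_conj hh) (hβ (k + 1)) (hτ k) (hτ1 k)
      (halg.B_succ k) (hB k) (halg.xhat_eq k) (halg.xbar_succ k) (hmax k).1 (hmax k).2
      (hprox k).1 (hprox k).2 (hconv k) hxs hy
  have hFY := fun k => inner_sub_conj_le hh hMxs (hmax k).1
  have hrec : ∀ k, ∀ y ∈ dom (conj h),
      f (xbar (k + 1)) + (g (xbar (k + 1))).toReal + ⟪M (xbar (k + 1)), y⟫_ℝ
          - (conj h y).toReal - β (k + 1) / 2 * normOp S (y - ydot) ^ 2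
          + τ k ^ 2 * B (k + 1) / 2 * ‖xtil (k + 1) - xs‖ ^ 2 ≤
        f xs + (g xs).toReal + (h (M xs)).toReal
          + τ k ^ 2 * B (k + 1) / 2 * ‖xtil 0 - xs‖ ^ 2 := by
    intro k
    induction k with
    | zero =>
      intro y hy
      have h1 := hstep 0 y hy
      have h2 := hFY 0
      simp only [halg.tau_zero] at h1 ⊢
      linarith
    | succ k ih =>
      intro y hy
      have h1 := hstep (k + 1) y hy
      -- The previous bound is used at the new maximizer, hence the quantification over `y` inside
      -- the induction. Its weight `β (k + 1) = (1 + τ (k + 1)) * β (k + 2)` is the one appearing in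
      -- `accelerated_step`.
      have h2 := mul_le_mul_of_nonneg_left (ih (ystar (k + 1)) (hmax (k + 1)).1)
        (by linarith [hτ1 (k + 1)] : 0 ≤ 1 - τ (k + 1))
      have h3 := mul_le_mul_of_nonneg_left (hFY (k + 1)) (hτ (k + 1)).le
      have h4 : (1 + τ (k + 1)) * β (k + 1 + 1) = β (k + 1) := by
        rw [halg.beta_succ (k + 1)]
        have := hτ (k + 1)
        field_simp
      have h5 := halg.tau_sq_mul_B hβ₀ hL hLM hS k
      rw [h4] at h1
      have h6 : τ (k + 1) ^ 2 * B (k + 1 + 1) = (1 - τ (k + 1)) * (τ k ^ 2 * B (k + 1)) := h5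
      rw [h6] at h1 ⊢
      linarith
  refine ⟨hdom k, fun y hy => ?_⟩
  have h1 := hrec k y hy
  have h2 : 0 ≤ τ k ^ 2 * B (k + 1) / 2 * ‖xtil (k + 1) - xs‖ ^ 2 := by
    have := hB k
    positivity
  have h3 := mul_le_mul_of_nonneg_right (halg.tau_sq_mul_B_le hβ₀ hL hLM hS k)
    (by positivity : 0 ≤ ‖xtil 0 - xs‖ ^ 2 / 2)
  have h4 : L / 2 + opNormInv S M ^ 2 / (2 * β 1) = B 1 / 2 := by
    rw [halg.B_succ 0, zero_add]
    have := hβ 1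
    field_simp
  rw [h4]
  linarith

end Parameters

/-! ### Lagrange multipliers in Hilbert spaces. -/

section Duality

variable {H G : Type*}
  [NormedAddCommGroup H] [InnerProductSpace ℝ H] [CompleteSpace H]
  [NormedAddCommGroup G] [InnerProductSpace ℝ G]

/-- A decreasing sequence of nonempty bounded closed convex sets has a common point. -/
theorem nonempty_iInter_of_antitone_convex {A : ℕ → Set H} (hanti : Antitone A)
    (hne : ∀ n, (A n).Nonempty) (hcl : ∀ n, IsClosed (A n)) (hcv : ∀ n, Convex ℝ (A n))
    (hbdd : Bornology.IsBounded (A 0)) : (⋂ n, A n).Nonempty := by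
  have hmin : ∀ n, ∃ v ∈ A n, ∀ w ∈ A n, ‖v‖ ^ 2 ≤ ⟪v, w⟫_ℝ := by
    intro n
    obtain ⟨v, hv, hvn⟩ := exists_norm_eq_iInf_of_complete_convex (hne n) (hcl n).isComplete
      (hcv n) 0
    refine ⟨v, hv, fun w hw => ?_⟩
    have := (norm_eq_iInf_iff_real_inner_le_zero (hcv n) hv).1 hvn w hw
    rw [zero_sub, inner_neg_left, inner_sub_right, real_inner_self_eq_norm_sq] at this
    linarith
  choose m hmA hm using hmin
  -- The minimal-norm points have increasing bounded norms, so this makes them a Cauchy sequence; no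
  -- weak topology is involved.
  have hdist : ∀ n k, n ≤ k → ‖m k - m n‖ ^ 2 ≤ ‖m k‖ ^ 2 - ‖m n‖ ^ 2 := by
    intro n k hnk
    have := hm n (m k) (hanti hnk (hmA k))
    rw [norm_sub_sq_real, real_inner_comm]
    linarith
  have hmono : Monotone fun n => ‖m n‖ ^ 2 := fun n k hnk => by
    have := hdist n k hnk
    have h2 := sq_nonneg ‖m k - m n‖
    simp only
    linarith
  obtain ⟨R, hR⟩ := hbdd.exists_norm_le
  have hbd : BddAbove (Set.range fun n => ‖m n‖ ^ 2) := by
    refine ⟨R ^ 2, ?_⟩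
    rintro _ ⟨n, rfl⟩
    exact pow_le_pow_left₀ (norm_nonneg _) (hR _ (hanti (Nat.zero_le n) (hmA n))) 2
  have hlim := tendsto_atTop_ciSup hmono hbd
  have hcau : CauchySeq m := by
    rw [Metric.cauchySeq_iff']
    intro ε hε
    obtain ⟨N, hN⟩ := Metric.cauchySeq_iff'.1 hlim.cauchySeq (ε ^ 2) (by positivity)
    refine ⟨N, fun n hn => ?_⟩
    have h1 := hN n hn
    rw [Real.dist_eq] at h1
    rw [dist_eq_norm]
    refine lt_of_pow_lt_pow_left₀ 2 hε.le ?_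
    exact (hdist N n hn).trans_lt ((le_abs_self _).trans_lt h1)
  obtain ⟨a, ha⟩ := cauchySeq_tendsto_of_complete hcau
  refine ⟨a, Set.mem_iInter.2 fun n => (hcl n).mem_of_tendsto ha ?_⟩
  filter_upwards [Filter.eventually_ge_atTop n] with k hk using hanti hk (hmA k)

/-- A bounded operator maps bounded closed convex sets to closed sets. -/
theorem isClosed_image_of_isBounded_convex (M : H →L[ℝ] G) {A : Set H} (hcl : IsClosed A)
    (hcv : Convex ℝ A) (hbdd : Bornology.IsBounded A) : IsClosed (M '' A) := by
  refine isClosed_of_closure_subset fun w hw => ?_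
  -- Points of `A` mapped ever closer to `w` form nested sets; a common point is mapped to `w`.
  obtain ⟨x, hx⟩ := nonempty_iInter_of_antitone_convex
    (A := fun n : ℕ => A ∩ M ⁻¹' Metric.closedBall w (1 / ((n : ℝ) + 1)))
    (fun n k hnk => Set.inter_subset_inter_right _ (Set.preimage_mono
      (Metric.closedBall_subset_closedBall (one_div_le_one_div_of_le (by positivity)
        (by exact_mod_cast Nat.succ_le_succ hnk)))))
    (fun n => by
      obtain ⟨_, ⟨x, hxA, rfl⟩, hx⟩ := Metric.mem_closure_iff.1 hw (1 / ((n : ℝ) + 1))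
        (by positivity)
      exact ⟨x, hxA, by rw [Set.mem_preimage, Metric.mem_closedBall, dist_comm]; exact hx.le⟩)
    (fun n => hcl.inter (Metric.isClosed_closedBall.preimage M.continuous))
    (fun n => hcv.inter ((convex_closedBall _ _).linear_preimage (M : H →ₗ[ℝ] G)))
    (hbdd.subset Set.inter_subset_left)
  rw [Set.mem_iInter] at hx
  refine ⟨x, (hx 0).1, ?_⟩
  have h0 : dist (M x) w ≤ 0 :=
    ge_of_tendsto' tendsto_one_div_add_atTop_nhds_zero_nat fun n => (hx n).2
  exact dist_le_zero.1 h0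

variable [CompleteSpace G]

/-- Existence of a Lagrange multiplier for the minimization of the convex function `φ` over the
points of `C` satisfying `M x = c`. -/
theorem exists_lagrange_multiplier (M : H →L[ℝ] G) {C : Set H} {φ : H → ℝ}
    (hφ : ConvexOn ℝ C φ) (hcl : ∀ r, IsClosed {x | x ∈ C ∧ φ x ≤ r}) {c : G} {x₀ : H}
    (hx₀ : x₀ ∈ relInterior C) (hMx₀ : M x₀ = c)
    (hM : IsClosed (M '' (vectorSpan ℝ C : Set H))) {m : ℝ}
    (hm : ∀ x ∈ C, M x = c → m ≤ φ x) :
    ∃ y : G, ∀ x ∈ C, m ≤ φ x + ⟪M x - c, y⟫_ℝ := by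
  obtain ⟨hx₀C, hcone⟩ := hx₀
  let W : Submodule ℝ G := (vectorSpan ℝ C).map (M : H →ₗ[ℝ] G)
  have hWcl : IsClosed (W : Set G) := by simpa [W] using hM
  have : CompleteSpace W := hWcl.completeSpace_coe
  have hmemW : ∀ x ∈ C, M x - c ∈ W := fun x hx =>
    ⟨x - x₀, vsub_mem_vectorSpan ℝ hx hx₀C, by simp [hMx₀]⟩
  have hWcone : ∀ w : W, ∃ t : ℝ, 0 < t ∧ ∃ z ∈ C, (w : G) = t • (M z - c) := by
    rintro ⟨_, v, hv, rfl⟩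
    obtain ⟨t, ht, z, hz, rfl⟩ := hcone v hv
    exact ⟨t, ht, z, hz, by simp [hMx₀]⟩
  -- a closed convex subset of `W` on which the value function is bounded above
  let A : Set H := {x | x ∈ C ∧ φ x ≤ φ x₀ + 1} ∩ Metric.closedBall x₀ 1
  have hAcl : IsClosed A := (hcl _).inter Metric.isClosed_closedBall
  have hAcv : Convex ℝ A := (hφ.convex_le _).inter (convex_closedBall _ _)
  have hAbd : Bornology.IsBounded A := Metric.isBounded_closedBall.subset Set.inter_subset_right
  have hx₀A : x₀ ∈ A := ⟨⟨hx₀C, by linarith⟩, Metric.mem_closedBall_self zero_le_one⟩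
  have hMA : IsClosed (M '' A) := isClosed_image_of_isBounded_convex M hAcl hAcv hAbd
  let K : Set W := {w | (w : G) + c ∈ M '' A}
  have hKcl : IsClosed K :=
    hMA.preimage (f := fun w : W => (w : G) + c) (by fun_prop)
  -- The cone condition makes the dilates `(n + 1) K` cover the complete space `W`, so Baire's
  -- theorem applies.
  have hKint : (interior K).Nonempty := by
    obtain ⟨n, hn⟩ := nonempty_interior_of_iUnion_of_closed
      (f := fun n : ℕ => (fun w : W => ((n : ℝ) + 1)⁻¹ • w) ⁻¹' K)
      (fun n => hKcl.preimage (continuous_const_smul _)) (by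
        refine Set.eq_univ_of_forall fun w => Set.mem_iUnion.2 ?_
        obtain ⟨t, ht, z, hz, hw⟩ := hWcone w
        -- With this `n`, moving by the fraction `t / (n + 1)` from `x₀` to `z` stays in the
        -- segment, in the sublevel set and in the unit ball.
        obtain ⟨n, hn⟩ := exists_nat_ge (t * (1 + |φ z - φ x₀| + ‖z - x₀‖))
        set s : ℝ := t / ((n : ℝ) + 1) with hs
        have hs0 : 0 < s := by positivity
        have hsb : s * (1 + |φ z - φ x₀| + ‖z - x₀‖) ≤ 1 := by
          rw [hs, div_mul_eq_mul_div, div_le_one (by positivity)]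
          linarith
        have hb1 := mul_nonneg hs0.le (abs_nonneg (φ z - φ x₀))
        have hb2 := mul_nonneg hs0.le (norm_nonneg (z - x₀))
        have hs1 : s ≤ 1 := by nlinarith
        refine ⟨n, x₀ + s • (z - x₀), ⟨⟨?_, ?_⟩, ?_⟩, ?_⟩
        · exact hφ.1.add_smul_sub_mem hx₀C hz ⟨hs0.le, hs1⟩
        · have h1 := hφ.2 hx₀C hz (by linarith : 0 ≤ 1 - s) hs0.le (by ring)
          rw [show (1 - s) • x₀ + s • z = x₀ + s • (z - x₀) by module] at h1
          simp only [smul_eq_mul] at h1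
          have h2 := mul_le_mul_of_nonneg_left (le_abs_self (φ z - φ x₀)) hs0.le
          linarith
        · rw [Metric.mem_closedBall, dist_eq_norm, add_sub_cancel_left, norm_smul,
            Real.norm_eq_abs, abs_of_pos hs0]
          linarith
        · simp only [map_add, map_smul, map_sub, hMx₀, Submodule.coe_smul, hw]
          rw [smul_smul, hs, inv_mul_eq_div, add_comm])
    have hpos : ((n : ℝ) + 1)⁻¹ ≠ 0 := by positivity
    refine (hn.image fun w : W => ((n : ℝ) + 1)⁻¹ • w).mono ?_
    refine interior_maximal ?_ (isOpenMap_smul₀ hpos _ isOpen_interior)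
    rintro _ ⟨w, hw, rfl⟩
    exact interior_subset (s := (fun w : W => ((n : ℝ) + 1)⁻¹ • w) ⁻¹' K) hw
  -- the epigraph of the value function
  let E : Set (W × ℝ) := {p | ∃ x ∈ C, M x - c = p.1 ∧ φ x ≤ p.2}
  have hEcv : Convex ℝ E := by
    rintro ⟨v, r⟩ ⟨x, hx, hxv, hxr⟩ ⟨w, s⟩ ⟨z, hz, hzw, hzs⟩ a b ha hb hab
    refine ⟨a • x + b • z, hφ.1 hx hz ha hb hab, ?_, ?_⟩
    · simp only [map_add, map_smul, Prod.smul_mk, Prod.mk_add_mk, Submodule.coe_add,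
        Submodule.coe_smul] at hxv hzw ⊢
      rw [← hxv, ← hzw, smul_sub, smul_sub, sub_add_sub_comm, ← add_smul, hab, one_smul]
    · have h1 := hφ.2 hx hz ha hb hab
      have h2 := mul_le_mul_of_nonneg_left hxr ha
      have h3 := mul_le_mul_of_nonneg_left hzs hb
      simp only [smul_eq_mul, Prod.smul_mk, Prod.mk_add_mk] at h1 h2 h3 ⊢
      linarith
  have hEint : (interior E).Nonempty := by
    obtain ⟨w, hw⟩ := hKint
    refine ⟨(w, φ x₀ + 2), mem_interior.2 ⟨interior K ×ˢ Set.Ioi (φ x₀ + 1), ?_,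
      isOpen_interior.prod isOpen_Ioi, hw, by simp⟩⟩
    rintro ⟨v, r⟩ ⟨hv, hr⟩
    obtain ⟨x, hx, hxv⟩ := interior_subset hv
    exact ⟨x, hx.1.1, by simp [hxv], hx.1.2.trans (le_of_lt hr)⟩
  -- An interior point could be lowered to `(0, m - e)` with `e > 0`, giving a feasible value below
  -- `m`.
  have hnot : ((0 : W), m) ∉ interior E := by
    intro h0
    have hcont : Filter.Tendsto (fun e : ℝ => ((0 : W), m - e)) (nhds 0) (nhds ((0 : W), m)) := by
      have : Continuous fun e : ℝ => ((0 : W), m - e) := by fun_prop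
      simpa using this.tendsto 0
    have hev := hcont.eventually (isOpen_interior.mem_nhds h0)
    obtain ⟨e, he, he0⟩ := ((hev.filter_mono nhdsWithin_le_nhds).and
      (self_mem_nhdsWithin (s := Set.Ioi (0 : ℝ)))).exists
    obtain ⟨x, hx, hxc, hxm⟩ := interior_subset he
    have := hm x hx (sub_eq_zero.1 hxc)
    have he0' : 0 < e := he0
    simp only at hxm
    linarith
  obtain ⟨ℓ, hℓ0, hℓ⟩ := geometric_hahn_banach_of_nonempty_interior_point hEcv hnot hEint
  set s : ℝ := ℓ (0, 1) with hs
  let ℓW : StrongDual ℝ W := ℓ.comp (ContinuousLinearMap.inl ℝ W ℝ)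
  have hsplit : ∀ w r, ℓ (w, r) = ℓW w + s * r := by
    intro w r
    have : ((w, r) : W × ℝ) = (w, 0) + r • ((0 : W), (1 : ℝ)) := by simp
    rw [this, map_add, map_smul, smul_eq_mul, mul_comm]
    rfl
  have hsep : ∀ x (hx : x ∈ C) r, φ x ≤ r → ℓW ⟨M x - c, hmemW x hx⟩ + s * r ≤ s * m := by
    intro x hx r hr
    have := hℓ (⟨M x - c, hmemW x hx⟩, r) ⟨x, hx, rfl, hr⟩
    simpa only [hsplit, map_zero, zero_add] using this
  have hs_nonpos : s ≤ 0 := by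
    by_contra hpos
    push Not at hpos
    have h1 := hsep x₀ hx₀C (φ x₀ + 1) (by linarith)
    have h2 : (⟨M x₀ - c, hmemW x₀ hx₀C⟩ : W) = 0 := Subtype.ext (sub_eq_zero.2 hMx₀)
    rw [h2, map_zero, zero_add] at h1
    have h3 := le_of_mul_le_mul_left h1 hpos
    linarith [hm x₀ hx₀C hMx₀]
  -- A vertical hyperplane is excluded: `ℓW` would be nonpositive on the cone generated by `M C -
  -- c`, which is all of `W`, so `ℓ` would vanish.
  have hs_ne : s ≠ 0 := by
    intro hs0
    have hle : ∀ w, ℓW w ≤ 0 := by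
      intro w
      obtain ⟨t, ht, z, hz, hw⟩ := hWcone w
      have h1 := hsep z hz _ le_rfl
      have h2 : w = t • ⟨M z - c, hmemW z hz⟩ := Subtype.ext hw
      rw [hs0, zero_mul, zero_mul, add_zero] at h1
      rw [h2, map_smul, smul_eq_mul]
      exact mul_nonpos_of_nonneg_of_nonpos ht.le h1
    have hzero : ∀ w, ℓW w = 0 := fun w => le_antisymm (hle w) (by
      have := hle (-w)
      rw [map_neg] at this
      linarith)
    refine hℓ0 (ContinuousLinearMap.ext fun p => ?_)
    rw [hsplit p.1 p.2, hzero, hs0]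
    simp
  have hs_neg : s < 0 := lt_of_le_of_ne hs_nonpos hs_ne
  let u : W := (InnerProductSpace.toDual ℝ W).symm ℓW
  refine ⟨s⁻¹ • (u : G), fun x hx => ?_⟩
  have h1 := hsep x hx _ le_rfl
  have h2 : ℓW ⟨M x - c, hmemW x hx⟩ = ⟪M x - c, (u : G)⟫_ℝ := by
    rw [real_inner_comm, ← InnerProductSpace.toDual_symm_apply (𝕜 := ℝ) (E := W), Submodule.coe_inner]
  rw [inner_smul_right, ← h2]
  have h3 : s * (φ x + s⁻¹ * ℓW ⟨M x - c, hmemW x hx⟩) ≤ s * m := by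
    rw [mul_add, mul_inv_cancel_left₀ hs_ne]
    linarith
  exact (mul_le_mul_left_of_neg hs_neg).1 h3

end Duality

/-- The set is the preimage of the closed epigraph of `g` under `x ↦ (x, r - f x)`. -/
theorem isClosed_sublevel_add {E : Type*} [NormedAddCommGroup E] [InnerProductSpace ℝ E]
    {f : E → ℝ} (hf : Continuous f) {g : E → EReal} (hg : IsProperLscConvex g) (r : ℝ) :
    IsClosed {x | x ∈ dom g ∧ f x + (g x).toReal ≤ r} := by
  have h1 : IsClosed ((fun x => (x, ((r - f x : ℝ) : EReal))) ⁻¹' {p : E × EReal | g p.1 ≤ p.2}) :=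
    hg.lsc.isClosed_epigraph.preimage
      (continuous_id.prodMk (continuous_coe_real_ereal.comp (by fun_prop)))
  convert h1 using 1
  ext x
  simp only [Set.mem_ofPred_eq, Set.mem_preimage]
  constructor
  · rintro ⟨hx, hle⟩
    rw [← coe_toReal_of_mem_dom hg.ne_bot hx, EReal.coe_le_coe_iff]
    linarith
  · intro hle
    have hx : x ∈ dom g := hle.trans_lt (EReal.coe_lt_top _)
    rw [← coe_toReal_of_mem_dom hg.ne_bot hx, EReal.coe_le_coe_iff] at hle
    exact ⟨hx, by linarith⟩

/-! ### Subgradients of Lipschitz convex functions. -/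

section Lipschitz

variable {G : Type*} [NormedAddCommGroup G] [InnerProductSpace ℝ G]
  {h : G → EReal} {S : G →L[ℝ] G} {D : ℝ}

theorem mem_dom_of_lipschitz (hh : IsProperLscConvex h)
    (hlip : ∀ u v : G, h u ≤ h v + ((D * normOp S.inverse (u - v) : ℝ) : EReal)) (u : G) :
    u ∈ dom h := by
  obtain ⟨v, hv⟩ := hh.exists_lt_top
  exact (hlip u v).trans_lt (EReal.add_lt_top hv.ne (EReal.coe_ne_top _))

variable [CompleteSpace G]

/-- A proper lower semicontinuous convex function which is finite everywhere is
subdifferentiable. -/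
theorem exists_subgradient (hh : IsProperLscConvex h) (hdom : ∀ u, u ∈ dom h)
    (u : G) : ∃ y : G, ∀ v, (h u).toReal + ⟪v - u, y⟫_ℝ ≤ (h v).toReal := by
  have huniv : dom h = Set.univ := Set.eq_univ_of_forall hdom
  -- A subgradient at `u` is minus a multiplier for the constraint `x = u`.
  obtain ⟨y, hy⟩ := exists_lagrange_multiplier (ContinuousLinearMap.id ℝ G) (c := u) (x₀ := u)
    (m := (h u).toReal) hh.convexOn_toReal
    (fun r => by simpa using isClosed_sublevel_add (continuous_const (y := (0 : ℝ))) hh r)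
    ⟨hdom u, fun v _ => ⟨1, one_pos, u + v, hdom _, by simp⟩⟩ rfl
    (by
      have htop : vectorSpan ℝ (dom h) = ⊤ := by
        refine eq_top_iff.2 fun v _ => ?_
        simpa using vsub_mem_vectorSpan ℝ (hdom (u + v)) (hdom u)
      simp [htop])
    (fun x _ hx => by rw [← show x = u from hx])
  refine ⟨-y, fun v => ?_⟩
  have := hy v (hdom v)
  simp only [ContinuousLinearMap.coe_id', id_eq] at this
  rw [inner_neg_right]
  linarith

/-- The maximum in the definition of the biconjugate is attained, in the ball of radius `|D|`. -/
theorem exists_conj_attained_of_lipschitz (hh : IsProperLscConvex h) (hS : IsPositiveDefinite S)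
    (hlip : ∀ u v : G, h u ≤ h v + ((D * normOp S.inverse (u - v) : ℝ) : EReal)) (u : G) :
    ∃ y ∈ dom (conj h), (h u).toReal ≤ ⟪u, y⟫_ℝ - (conj h y).toReal ∧ normOp S y ^ 2 ≤ D ^ 2 := by
  have hdom := mem_dom_of_lipschitz hh hlip
  obtain ⟨y, hy⟩ := exists_subgradient hh hdom u
  have hle : conj h y ≤ ((⟪u, y⟫_ℝ - (h u).toReal : ℝ) : EReal) := by
    rw [conj_le_coe_iff hh.ne_bot]
    intro v _
    have := hy v
    rw [inner_sub_left] at this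
    linarith
  have hyd : y ∈ dom (conj h) := hle.trans_lt (EReal.coe_lt_top _)
  refine ⟨y, hyd, ?_, ?_⟩
  · rw [← coe_toReal_of_mem_dom (conj_ne_bot hh) hyd, EReal.coe_le_coe_iff] at hle
    linarith
  -- In the direction `S y`, the subgradient inequality and the Lipschitz bound give `‖y‖_S² ≤ D
  -- ‖y‖_S`; the sign of `D` is irrelevant to the squared conclusion.
  · have h1 := hlip (u + S y) u
    rw [← coe_toReal_of_mem_dom hh.ne_bot (hdom u),
      ← coe_toReal_of_mem_dom hh.ne_bot (hdom (u + S y)), ← EReal.coe_add,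
      EReal.coe_le_coe_iff, add_sub_cancel_left, hS.normOp_inverse_apply] at h1
    have h2 := hy (u + S y)
    rw [add_sub_cancel_left, real_inner_comm, ← hS.normOp_sq] at h2
    nlinarith [sq_nonneg (normOp S y - D)]

end Lipschitz

section Indicator

theorem mem_dom_indicatorPoint {G : Type*} {c u : G} : u ∈ dom (indicatorPoint c) ↔ u = c := by
  by_cases hu : u = c <;> simp [dom, indicatorPoint, hu]

variable {G : Type*} [NormedAddCommGroup G] [InnerProductSpace ℝ G]

theorem conj_indicatorPoint (c y : G) : conj (indicatorPoint c) y = ((⟪c, y⟫_ℝ : ℝ) : EReal) := by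
  refine le_antisymm (iSup_le fun u => ?_) (le_iSup_of_le c (by simp [indicatorPoint]))
  by_cases hu : u = c <;> simp [indicatorPoint, hu]

end Indicator

/-! ### Primal and dual solutions. -/

section Solutions

variable {H G : Type*}
  [NormedAddCommGroup H] [InnerProductSpace ℝ H]
  [NormedAddCommGroup G] [InnerProductSpace ℝ G]
  {f : H → ℝ} {g : H → EReal} {h : G → EReal} {M : H →L[ℝ] G}

theorem primalObj_eq_coe (hg : IsProperLscConvex g) (hh : IsProperLscConvex h) {x : H}
    (hx : x ∈ dom g) (hMx : M x ∈ dom h) :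
    primalObj f g h M x = ((f x + (g x).toReal + (h (M x)).toReal : ℝ) : EReal) := by
  rw [primalObj, EReal.coe_add, EReal.coe_add, coe_toReal_of_mem_dom hg.ne_bot hx,
    coe_toReal_of_mem_dom hh.ne_bot hMx]

theorem mem_dom_of_mem_primalSolutions (hg : IsProperLscConvex g) (hh : IsProperLscConvex h)
    (hdom : ∃ x, x ∈ dom g ∧ M x ∈ dom h) {xs : H} (hxs : xs ∈ primalSolutions f g h M) :
    xs ∈ dom g ∧ M xs ∈ dom h := by
  obtain ⟨x, hx, hMx⟩ := hdom
  have h1 := hxs x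
  rw [primalObj_eq_coe hg hh hx hMx] at h1
  have h2 : primalObj f g h M xs ≠ ⊤ := (h1.trans_lt (EReal.coe_lt_top _)).ne
  constructor
  · by_contra hn
    refine h2 ?_
    rw [primalObj, show g xs = ⊤ from not_lt_top_iff.1 hn, EReal.coe_add_top,
      EReal.top_add_of_ne_bot (hh.ne_bot _)]
  · by_contra hn
    refine h2 ?_
    rw [primalObj, show h (M xs) = ⊤ from not_lt_top_iff.1 hn, EReal.add_top_of_ne_bot]
    rw [Ne, EReal.add_eq_bot_iff]
    simp [hg.ne_bot xs]

theorem lagrangian_indicatorPoint (hg : IsProperLscConvex g) (c : G) {x : H} (hx : x ∈ dom g)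
    (y : G) : lagrangian f g (indicatorPoint c) M x y =
      ((f x + (g x).toReal + ⟪M x - c, y⟫_ℝ : ℝ) : EReal) := by
  rw [lagrangian, conj_indicatorPoint, ← coe_toReal_of_mem_dom hg.ne_bot hx, inner_sub_left,
    ← add_sub_assoc]
  simp only [EReal.toReal_coe, EReal.coe_add, EReal.coe_sub]

theorem lagrangian_indicatorPoint_of_notMem (c : G) {x : H} (hx : x ∉ dom g) (y : G) :
    lagrangian f g (indicatorPoint c) M x y = ⊤ := by
  rw [lagrangian, conj_indicatorPoint, show g x = ⊤ from not_lt_top_iff.1 hx, EReal.coe_add_top,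
    EReal.top_add_coe, EReal.top_sub_coe]

/-- Under either qualification condition, a dual solution is a Lagrange multiplier. -/
theorem le_lagrangian_of_mem_dualSolutions [CompleteSpace H] [CompleteSpace G]
    (hfc : ConvexOn ℝ Set.univ f) (hfcont : Continuous f)
    (hg : IsProperLscConvex g) {c : G} (hri : ∃ x, x ∈ relInterior (dom g) ∧ M x = c)
    {xs : H} (hxsg : xs ∈ dom g) (hMxs : M xs = c)
    (hmin : ∀ x ∈ dom g, M x = c → f xs + (g xs).toReal ≤ f x + (g x).toReal) {ys : G}
    (hys : ys ∈ dualSolutions f g (indicatorPoint c) M)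
    (hq : IsClosed (M '' (vectorSpan ℝ (dom g) : Set H)) ∨
      IsSaddlePoint f g (indicatorPoint c) M xs ys) :
    ∀ x ∈ dom g, f xs + (g xs).toReal ≤ f x + (g x).toReal + ⟪M x - c, ys⟫_ℝ := by
  intro x hx
  rcases hq with hcl | hsad
  · obtain ⟨x₀, hx₀, hMx₀⟩ := hri
    obtain ⟨y, hy⟩ := exists_lagrange_multiplier M
      ((hfc.subset (Set.subset_univ _) hg.convexOn_toReal.1).add hg.convexOn_toReal)
      (isClosed_sublevel_add hfcont hg) hx₀ hMx₀ hcl hmin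
    -- The multiplier `y` may differ from `ys`, but it forces the maximal dual value up to the
    -- primal one, and `ys` attains that maximum.
    have h1 : ((f xs + (g xs).toReal : ℝ) : EReal) ≤ dualObj f g (indicatorPoint c) M y := by
      refine le_iInf fun z => ?_
      by_cases hz : z ∈ dom g
      · rw [lagrangian_indicatorPoint hg c hz, EReal.coe_le_coe_iff]
        exact hy z hz
      · rw [lagrangian_indicatorPoint_of_notMem c hz]
        exact le_top
    have h2 := (h1.trans (hys y)).trans (iInf_le _ x)
    rwa [lagrangian_indicatorPoint hg c hx, EReal.coe_le_coe_iff] at h2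
  · have h1 := (hsad x ys).2
    rw [lagrangian_indicatorPoint hg c hx, lagrangian_indicatorPoint hg c hxsg,
      EReal.coe_le_coe_iff, hMxs, sub_self, inner_zero_left, add_zero] at h1
    exact h1

end Solutions

/-- The bound on a root of a quadratic inequality, with `b` relaxed to `b'`. -/
theorem le_mul_add_sqrt {r a b b' C : ℝ} (hr : 0 ≤ r) (ha : 0 ≤ a) (hb : 0 < b) (hbb' : b ≤ b')
    (hC : 0 ≤ C) (h : 1 / (2 * b) * r ^ 2 - a * r ≤ C) :
    r ≤ b' * (a + √(a ^ 2 + 2 / b' * C)) := by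
  have hb' : 0 < b' := hb.trans_le hbb'
  have h1 : r ^ 2 - 2 * b * a * r ≤ 2 * b * C := by
    have := mul_le_mul_of_nonneg_left h (by positivity : 0 ≤ 2 * b)
    have e : 2 * b * (1 / (2 * b) * r ^ 2 - a * r) = r ^ 2 - 2 * b * a * r := by
      field_simp
    linarith
  have h2 : r ^ 2 - 2 * b' * a * r ≤ 2 * b' * C := by
    have := mul_nonneg (sub_nonneg.2 hbb') (mul_nonneg ha hr)
    have := mul_nonneg (sub_nonneg.2 hbb') hC
    linarith
  -- Completing the square in `r / b'`.
  have h3 : (r / b' - a) ≤ √(a ^ 2 + 2 / b' * C) := by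
    refine Real.le_sqrt_of_sq_le ?_
    have e : (r / b' - a) ^ 2 = (r ^ 2 - 2 * b' * a * r) / b' ^ 2 + a ^ 2 := by
      field_simp
      ring
    have e2 : 2 / b' * C = (2 * b' * C) / b' ^ 2 := by field_simp
    rw [e, e2, add_comm]
    gcongr
  have h4 : r / b' ≤ a + √(a ^ 2 + 2 / b' * C) := by linarith
  rwa [div_le_iff₀' hb'] at h4

end SmoothASGARD

end

/-! ### The convergence rates. -/

theorem theorem1 {H G : Type*}
    [NormedAddCommGroup H] [InnerProductSpace ℝ H] [CompleteSpace H]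
    [NormedAddCommGroup G] [InnerProductSpace ℝ G] [CompleteSpace G]
    (f : H → ℝ) (g : H → EReal) (h : G → EReal) (M : H →L[ℝ] G) (L : ℝ)
    (hL : 0 ≤ L) (hLM : 0 < L ∨ M ≠ 0)
    (hf : SmoothASGARD.IsConvexWithLipschitzGradient f L)
    (hg : SmoothASGARD.IsProperLscConvex g)
    (hh : SmoothASGARD.IsProperLscConvex h)
    (hdom : ∃ x, x ∈ SmoothASGARD.dom g ∧ M x ∈ SmoothASGARD.dom h)
    (S : G →L[ℝ] G) (hS : SmoothASGARD.IsPositiveDefinite S) (ydot : G)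
    (β₀ : ℝ) (hβ₀ : 0 < β₀) (τ β B : ℕ → ℝ) (xhat xbar xtil : ℕ → H) (ystar : ℕ → G)
    (halg : SmoothASGARD.IsLinearizedASGARD f g h M S ydot L β₀ τ β B xhat xbar xtil ystar) :
    -- equality constraints
    (∀ c : G, h = SmoothASGARD.indicatorPoint c →
      (∃ x, x ∈ SmoothASGARD.relInterior (SmoothASGARD.dom g) ∧ M x = c) →
      ∀ xs ∈ SmoothASGARD.primalSolutions f g h M, ∀ ys ∈ SmoothASGARD.dualSolutions f g h M,
      (IsClosed (M '' (vectorSpan ℝ (SmoothASGARD.dom g) : Set H)) ∨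
        SmoothASGARD.IsSaddlePoint f g h M xs ys) →
      ∀ k : ℕ,
        (((-(SmoothASGARD.normOp S ys * SmoothASGARD.normOp S.inverse (M (xbar (k + 1)) - c)) : ℝ) :
            EReal) ≤ ((f (xbar (k + 1)) : EReal) + g (xbar (k + 1))) - ((f xs : EReal) + g xs)) ∧
        (((f (xbar (k + 1)) : EReal) + g (xbar (k + 1))) - ((f xs : EReal) + g xs) ≤
          ((1 / ((k : ℝ) + 1) * (L / 2 + SmoothASGARD.opNormInv S M ^ 2 / (2 * β 1))
                * ‖xtil 0 - xs‖ ^ 2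
              + SmoothASGARD.normOp S ys * SmoothASGARD.normOp S.inverse (M (xbar (k + 1)) - c)
              + β₀ / (2 * ((k : ℝ) + 1)) * SmoothASGARD.normOp S (ys - ydot) ^ 2 : ℝ) : EReal)) ∧
        SmoothASGARD.normOp S.inverse (M (xbar (k + 1)) - c) ≤
          β₀ / ((k : ℝ) + 1) * (SmoothASGARD.normOp S (ys - ydot)
            + √(SmoothASGARD.normOp S (ys - ydot) ^ 2
                + 2 / β₀ * (L / 2 + SmoothASGARD.opNormInv S M ^ 2 / (2 * β 1))
                  * ‖xtil 0 - xs‖ ^ 2))) ∧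
    -- Lipschitz continuous `h`
    (∀ D : ℝ, (∀ u v : G, h u ≤ h v + ((D * SmoothASGARD.normOp S.inverse (u - v) : ℝ) : EReal)) →
      ∀ xs ∈ SmoothASGARD.primalSolutions f g h M, ∀ k : ℕ,
        SmoothASGARD.primalObj f g h M (xbar (k + 1))
            - (⨅ x, SmoothASGARD.primalObj f g h M x) ≤
          ((1 / ((k : ℝ) + 1) * (L / 2 + SmoothASGARD.opNormInv S M ^ 2 / (2 * β 1))
                * ‖xtil 0 - xs‖ ^ 2
              + β₀ / ((k : ℝ) + 1) * (D ^ 2 + SmoothASGARD.normOp S ydot ^ 2) : ℝ) : EReal)) := by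
  open SmoothASGARD in
  constructor
  · intro c hc hri xs hxs ys hys hq k
    subst hc
    obtain ⟨hxsg, hMxs⟩ := mem_dom_of_mem_primalSolutions hg hh hdom hxs
    have hMc : M xs = c := mem_dom_indicatorPoint.1 hMxs
    have hmin : ∀ x ∈ dom g, M x = c → f xs + (g xs).toReal ≤ f x + (g x).toReal := by
      intro x hx hMx
      have h1 := hxs x
      rw [primalObj_eq_coe hg hh hxsg hMxs, primalObj_eq_coe hg hh hx
        (mem_dom_indicatorPoint.2 hMx), EReal.coe_le_coe_iff, hMc, hMx] at h1
      linarith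
    have hlag := le_lagrangian_of_mem_dualSolutions hf.convex hf.differentiable.continuous hg hri
      hxsg hMc hmin hys hq
    have hcd : ∀ y, y ∈ dom (conj (indicatorPoint c)) := fun y => by
      simp [dom, conj_indicatorPoint]
    obtain ⟨hxb, hgap⟩ := halg.smoothed_gap_le hβ₀ hL hLM hf hg hh hS ⟨0, hcd 0⟩ hxsg hMxs k
    have hβ := halg.beta_pos hβ₀ (k + 1)
    have hβle := halg.beta_succ_le hβ₀ hL hLM hS k
    have hβ1 := halg.beta_pos hβ₀ 1
    have hk : (0 : ℝ) < (k : ℝ) + 1 := by positivity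
    have hzero : (indicatorPoint c (M xs)).toReal = 0 := by simp [indicatorPoint, hMc]
    set r := M (xbar (k + 1)) - c with hr
    set A := (L / 2 + opNormInv S M ^ 2 / (2 * β 1)) * ‖xtil 0 - xs‖ ^ 2 with hA
    have hA0 : 0 ≤ A := by positivity
    have hgap' : ∀ y, f (xbar (k + 1)) + (g (xbar (k + 1))).toReal + ⟪r, y⟫_ℝ
        - β (k + 1) / 2 * normOp S (y - ydot) ^ 2 ≤
          f xs + (g xs).toReal + 1 / ((k : ℝ) + 1) * A := by
      intro y
      have h1 := hgap y (hcd y)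
      rw [conj_indicatorPoint, EReal.toReal_coe, hzero] at h1
      rw [hr, inner_sub_left, hA]
      linarith
    have hlow := hlag _ hxb
    have hdiff : ((f (xbar (k + 1)) : EReal) + g (xbar (k + 1))) - ((f xs : EReal) + g xs) =
        ((f (xbar (k + 1)) + (g (xbar (k + 1))).toReal - (f xs + (g xs).toReal) : ℝ) : EReal) := by
      rw [EReal.coe_sub, EReal.coe_add, EReal.coe_add, coe_toReal_of_mem_dom hg.ne_bot hxb,
        coe_toReal_of_mem_dom hg.ne_bot hxsg]
    rw [hdiff, EReal.coe_le_coe_iff, EReal.coe_le_coe_iff]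
    refine ⟨?_, ?_, ?_⟩
    · have := hS.inner_le r ys
      linarith
    · have h1 := hgap' ys
      have h2 := hS.neg_le_inner r ys
      have h3 : β (k + 1) / 2 * normOp S (ys - ydot) ^ 2 ≤
          β₀ / (2 * ((k : ℝ) + 1)) * normOp S (ys - ydot) ^ 2 := by
        refine mul_le_mul_of_nonneg_right ?_ (sq_nonneg _)
        calc β (k + 1) / 2 ≤ (β₀ / ((k : ℝ) + 1)) / 2 := by gcongr
          _ = _ := by field_simp
      rw [mul_assoc (1 / ((k : ℝ) + 1)), ← hA]
      linarith
    -- This point maximizes `⟪r, y⟫ - β/2 ‖y - ẏ‖_S²`, with value `⟪r, ẏ⟫ + ‖r‖²/(2β)` in the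
    -- inverse norm. Together with `hlow` it gives a quadratic inequality for the residual norm.
    · have h1 := hgap' (ydot + (β (k + 1))⁻¹ • S.inverse r)
      have h2 : ⟪r, ydot + (β (k + 1))⁻¹ • S.inverse r⟫_ℝ =
          ⟪r, ydot⟫_ℝ + 1 / β (k + 1) * normOp S.inverse r ^ 2 := by
        rw [inner_add_right, inner_smul_right, hS.normOp_inverse_sq, one_div]
      have h3 : β (k + 1) / 2 * normOp S (ydot + (β (k + 1))⁻¹ • S.inverse r - ydot) ^ 2 =
          1 / (2 * β (k + 1)) * normOp S.inverse r ^ 2 := by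
        have : normOp S ((β (k + 1))⁻¹ • S.inverse r) ^ 2 =
            (β (k + 1))⁻¹ ^ 2 * normOp S.inverse r ^ 2 := by
          rw [hS.normOp_sq, hS.normOp_inverse_sq, map_smul, hS.apply_inverse, inner_smul_right,
            real_inner_smul_left, real_inner_comm]
          ring
        rw [add_sub_cancel_left, this]
        field_simp
      rw [h2, h3] at h1
      have h4 := hS.inner_le r (ys - ydot)
      rw [inner_sub_right] at h4
      have h5 : 1 / β (k + 1) * normOp S.inverse r ^ 2 =
          2 * (1 / (2 * β (k + 1)) * normOp S.inverse r ^ 2) := by field_simp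
      have h6 := le_mul_add_sqrt (normOp_nonneg S.inverse r) (normOp_nonneg S (ys - ydot)) hβ hβle
        (by positivity : 0 ≤ 1 / ((k : ℝ) + 1) * A) (by linarith)
      -- Relaxing `β (k + 1)` to `β₀ / (k + 1)` makes the factors `k + 1` cancel under the root.
      have h7 : 2 / (β₀ / ((k : ℝ) + 1)) * (1 / ((k : ℝ) + 1) * A) = 2 / β₀ * A := by
        field_simp
      rw [h7] at h6
      rwa [mul_assoc (2 / β₀), ← hA]
  · intro D hlip xs hxs k
    obtain ⟨hxsg, hMxs⟩ := mem_dom_of_mem_primalSolutions hg hh hdom hxs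
    obtain ⟨y, hy, hattain, hyD⟩ :=
      exists_conj_attained_of_lipschitz hh hS hlip (M (xbar (k + 1)))
    obtain ⟨hxb, hgap⟩ := halg.smoothed_gap_le hβ₀ hL hLM hf hg hh hS ⟨y, hy⟩ hxsg hMxs k
    have hinf : (⨅ x, primalObj f g h M x) = primalObj f g h M xs :=
      le_antisymm (iInf_le _ xs) (le_iInf hxs)
    rw [hinf, primalObj_eq_coe hg hh hxsg hMxs,
      primalObj_eq_coe hg hh hxb (mem_dom_of_lipschitz hh hlip _), ← EReal.coe_sub,
      EReal.coe_le_coe_iff]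
    have h1 := hgap y hy
    have hβ := halg.beta_pos hβ₀ (k + 1)
    -- The factor 2 in `normOp_sub_sq_le` absorbs the one half in the smoothing term.
    have h2 : β (k + 1) / 2 * normOp S (y - ydot) ^ 2 ≤
        β₀ / ((k : ℝ) + 1) * (D ^ 2 + normOp S ydot ^ 2) :=
      calc β (k + 1) / 2 * normOp S (y - ydot) ^ 2
          ≤ β (k + 1) / 2 * (2 * (D ^ 2 + normOp S ydot ^ 2)) := by
            gcongr
            linarith [hS.normOp_sub_sq_le y ydot]
        _ = β (k + 1) * (D ^ 2 + normOp S ydot ^ 2) := by ring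
        _ ≤ _ := by
            gcongr
            exact halg.beta_succ_le hβ₀ hL hLM hS k
    linarith
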